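/- Let $T$ be a locally finite tree with vertex set $V$, let $G=\mathrm{Aut}(T)$ with the topology of pointwise convergence on the discrete set $V$, and let $E$ be a real Banach space with a linear isometric action of $G$. For $q\ge 0$ let $\mathrm{coh}^{q+1}\subseteq V^{q+1}$ be the set of coherent aligned tuples, i.e. tuples $(x_0,\dots,x_q)$ of distinct vertices lying on a common geodesic segment of $T$ and listed in increasing order for one of the two linear orders of that segment. For a set $X$, $\ell^\infty(X,E)$ is the Banach space of bounded maps $X\to E$, and $d$ denotes the homogeneous differential $(d\alpha)(x)=\sum_{i}(-1)^i\alpha(\dots,\widehat{x_i},\dots)$. Let $\tau_q$ be the permutation of $\{0,\dots,q\}$ reversing the order, let $\hat\tau_q$ be the involution of $\ell^\infty(\mathrm{coh}^{q+1},E)$ given by $(\hat\tau_q\alpha)(x_0,\dots,x_q)=\mathrm{sign}(\tau_q)\,\alpha(x_q,\dots,x_0)$, let $\ell^\infty_+(\mathrm{coh}^{q+1},E)$ be its $+1$ eigenspace, and let $A_q=(\hat\tau_q+\mathrm{Id})/2$ be the projection onto it. Then: (1) The complex $$0\to E\to \ell^\infty_+(\mathrm{coh}^1,E)\xrightarrow{d}\ell^\infty_+(\mathrm{coh}^2,E)\xrightarrow{d}\ell^\infty_+(\mathrm{coh}^3,E)\to\cdots,$$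 where $E\to \ell^\infty_+(\mathrm{coh}^1,E)$ is the inclusion of the constant maps, is exact. (2) Let $H_{cb}^q(G,E)$ be the continuous bounded cohomology, i.e. the cohomology of the complex of $G$-equivariant continuous bounded maps $G^{q+1}\to E$. For every vertex $v$ and every $q\ge0$, the orbit map $\alpha\mapsto\big((g_0,\dots,g_q)\mapsto\alpha(g_0v,\dots,g_qv)\big)$ induces a topological isomorphism from the $q$-th cohomology of $$0\to\ell^\infty(V,E)^{G}\to\ell^\infty(V^2,E)^{G}\to\ell^\infty(V^3,E)^G\to\cdots$$ onto $H_{cb}^q(G,E)$. Under this identification (which does not depend on $v$), restriction to coherent tuples followed by the projection $A_q$ induces an isomorphism, also topological, from $H_{cb}^q(G,E)$ onto the $q$-th cohomology of the complex $$0\to \ell^\infty_+(\mathrm{coh}^1,E)^{G}\to\ell^\infty_+(\mathrm{coh}^2,E)^{G}\to\ell^\infty_+(\mathrm{coh}^3,E)^{G}\to\cdots.$$ -/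

import Mathlib

open scoped ENNReal

noncomputable section

namespace AlignedCochains

/-! ### Cohomology of a complex of normed spaces -/

section Complexes

variable {C D : ℕ → Type*} [∀ n, NormedAddCommGroup (C n)] [∀ n, NormedSpace ℝ (C n)]
  [∀ n, NormedAddCommGroup (D n)] [∀ n, NormedSpace ℝ (D n)]

/-- The coboundaries in degree `n` of `0 → C 0 → C 1 → C 2 → ⋯`. -/
def coboundaries (d : ∀ n, C n →L[ℝ] C (n + 1)) : ∀ n, Submodule ℝ (C n)
  | 0 => ⊥
  | n + 1 => (d n).range

/-- The `n`-th cohomology of `0 → C 0 → C 1 → C 2 → ⋯`: cocycles modulo coboundaries,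
with the quotient (possibly non-Hausdorff) topology. -/
abbrev Cohomology (d : ∀ n, C n →L[ℝ] C (n + 1)) (n : ℕ) : Type _ :=
  (d n).ker ⧸ (coboundaries d n).submoduleOf (d n).ker

/-- The map induced on cohomology by a chain map `f`; it sends the class of a cocycle `z` to the
class of `f n z`. -/
def Cohomology.map {d : ∀ n, C n →L[ℝ] C (n + 1)} {d' : ∀ n, D n →L[ℝ] D (n + 1)}
    (f : ∀ n, C n →L[ℝ] D n) (hf : ∀ n x, f (n + 1) (d n x) = d' n (f n x)) (n : ℕ) :
    Cohomology d n →L[ℝ] Cohomology d' n :=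
  Submodule.liftQL _
    (((coboundaries d' n).submoduleOf (d' n).ker).mkQL.comp
      ((f n).restrict (p := (d n).ker) (q := (d' n).ker) (fun x hx => by
        have hx' : d n x = 0 := hx
        change d' n (f n x) = 0
        rw [← hf, hx', map_zero])))
    (by
      rintro ⟨x, hx⟩ hxb
      refine (Submodule.Quotient.mk_eq_zero _).2 ?_
      change f n x ∈ coboundaries d' n
      cases n with
      | zero =>
        have h0 : x = 0 := hxb
        change f 0 x = 0
        rw [h0, map_zero]
      | succ n =>
        obtain ⟨y, hy⟩ := hxb
        have hy' : d n y = x := hy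
        exact ⟨f n y, by change d' n (f n y) = f (n + 1) x; rw [← hf, hy']⟩)

end Complexes

/-! ### Bounded functions and the homogeneous differential -/

/-- `ℓ^∞(X, E)`, with the sup norm. -/
abbrev LInf (X E : Type*) [NormedAddCommGroup E] : Type _ := lp (fun _ : X => E) ∞

section LInf

variable {E : Type*} [NormedAddCommGroup E] [NormedSpace ℝ E]

/-- Precomposition `α ↦ α ∘ f`. -/
def LInf.comp {X Y : Type*} (f : X → Y) : LInf Y E →L[ℝ] LInf X E :=
  LinearMap.mkContinuous
    { toFun := fun α => ⟨fun x => α (f x), memℓp_infty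
        ⟨‖α‖, by rintro _ ⟨x, rfl⟩; exact lp.norm_apply_le_norm ENNReal.top_ne_zero α (f x)⟩⟩
      map_add' := fun _ _ => rfl
      map_smul' := fun _ _ => rfl } 1
    (fun α => by
      rw [one_mul]
      exact lp.norm_le_of_forall_le (norm_nonneg _)
        (fun x => lp.norm_apply_le_norm ENNReal.top_ne_zero α (f x)))

@[simp] theorem LInf.comp_apply {X Y : Type*} (f : X → Y) (α : LInf Y E) (x : X) :
    LInf.comp f α x = α (f x) := rfl

/-- The inclusion of `E` as the constant functions. -/
def LInf.const (X : Type*) : E →L[ℝ] LInf X E :=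
  LinearMap.mkContinuous
    { toFun := fun e => ⟨fun _ => e, memℓp_infty ⟨‖e‖, by rintro _ ⟨x, rfl⟩; exact le_rfl⟩⟩
      map_add' := fun _ _ => rfl
      map_smul' := fun _ _ => rfl } 1
    (fun e => by
      rw [one_mul]
      exact lp.norm_le_of_forall_le (norm_nonneg _) (fun _ => le_rfl))

@[simp] theorem LInf.const_apply (X : Type*) (e : E) (x : X) : LInf.const X e x = e := rfl

/-- The alternating sum `α ↦ ∑ i, (-1)^i α ∘ δ i` over a family of face maps. -/
def diff {n : ℕ} {X Y : Type*} (δ : Fin n → X → Y) : LInf Y E →L[ℝ] LInf X E :=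
  ∑ i : Fin n, ((-1 : ℝ) ^ (i : ℕ)) • LInf.comp (δ i)

theorem diff_apply {n : ℕ} {X Y : Type*} (δ : Fin n → X → Y) (α : LInf Y E) (x : X) :
    diff δ α x = ∑ i : Fin n, ((-1 : ℝ) ^ (i : ℕ)) • α (δ i x) := by
  have h : diff δ α = ∑ i : Fin n, ((-1 : ℝ) ^ (i : ℕ)) • LInf.comp (δ i) α := by
    simp only [diff, sum_apply, smul_apply]
  rw [h, lp.coeFn_sum, Finset.sum_apply]
  rfl

/-- Omission of the `i`-th entry of an `(n + 2)`-tuple. -/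
def face {Y : Type*} (n : ℕ) (i : Fin (n + 2)) (x : Fin (n + 2) → Y) : Fin (n + 1) → Y :=
  fun j => x (i.succAbove j)

/-- The diagonal action of `G` on `G^n` by left multiplication. -/
def mulTuple {G : Type*} [Group G] {n : ℕ} (g : G) (x : Fin n → G) : Fin n → G := fun i => g * x i

/-- The `G`-equivariant bounded functions, for a map `act` giving the action of `G` on `X` and an
isometric linear representation `ρ` of `G` on `E`. -/
def equivariant {G X : Type*} [Group G] (ρ : G →* (E ≃ₗᵢ[ℝ] E)) (act : G → X → X) :
    Submodule ℝ (LInf X E) where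
  carrier := {α | ∀ g x, α (act g x) = ρ g (α x)}
  zero_mem' := fun g x => by simp
  add_mem' := fun {a b} ha hb g x => by
    simp only [lp.coeFn_add, Pi.add_apply, map_add, ha g x, hb g x]
  smul_mem' := fun c a ha g x => by
    simp only [lp.coeFn_smul, Pi.smul_apply, map_smul, ha g x]

theorem comp_mem_equivariant {G X Y : Type*} [Group G] {ρ : G →* (E ≃ₗᵢ[ℝ] E)}
    {actX : G → X → X} {actY : G → Y → Y} {f : X → Y} (hf : ∀ g x, f (actX g x) = actY g (f x))
    {α : LInf Y E} (hα : α ∈ equivariant ρ actY) : LInf.comp f α ∈ equivariant ρ actX :=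
  fun g x => by simp only [LInf.comp_apply, hf]; exact hα g (f x)

theorem diff_mem_equivariant {G X Y : Type*} [Group G] {ρ : G →* (E ≃ₗᵢ[ℝ] E)} {n : ℕ}
    {actX : G → X → X} {actY : G → Y → Y} {δ : Fin n → X → Y}
    (hδ : ∀ i g x, δ i (actX g x) = actY g (δ i x))
    {α : LInf Y E} (hα : α ∈ equivariant ρ actY) : diff δ α ∈ equivariant ρ actX := by
  simp only [diff, sum_apply]
  exact Submodule.sum_mem _ fun i _ =>
    Submodule.smul_mem _ _ (comp_mem_equivariant (hδ i) hα)

/-! ### Continuous bounded cohomology of a topological group -/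

section Cb

variable {G : Type*} [Group G] [TopologicalSpace G] (ρ : G →* (E ≃ₗᵢ[ℝ] E))

/-- `C_b(G^{n+1}, E)^G`: the continuous bounded functions `f : G^{n+1} → E` with
`f (g g₀, …, g gₙ) = g • f (g₀, …, gₙ)`, as a subspace of all bounded functions (sup norm). -/
def cbCochains (n : ℕ) : Submodule ℝ (LInf (Fin (n + 1) → G) E) where
  carrier := {f | Continuous (fun x => f x) ∧ f ∈ equivariant ρ mulTuple}
  zero_mem' := ⟨continuous_const, Submodule.zero_mem _⟩
  add_mem' := fun ha hb => ⟨ha.1.add hb.1, Submodule.add_mem _ ha.2 hb.2⟩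
  smul_mem' := fun c _ ha => ⟨ha.1.const_smul c, Submodule.smul_mem _ c ha.2⟩

theorem diff_mem_cbCochains (n : ℕ) (f : LInf (Fin (n + 1) → G) E) (hf : f ∈ cbCochains ρ n) :
    diff (face n) f ∈ cbCochains ρ (n + 1) := by
  have h2 : diff (face n) f ∈ equivariant ρ mulTuple :=
    diff_mem_equivariant (actY := mulTuple) (fun _ _ _ => rfl) hf.2
  have h : (fun x => diff (face n) f x) =
      fun x => ∑ i : Fin (n + 2), ((-1 : ℝ) ^ (i : ℕ)) • f (face n i x) := funext (diff_apply _ f)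
  have h1 : Continuous (fun x => diff (face n) f x) := by
    rw [h]
    refine continuous_finsetSum _ fun i _ => Continuous.const_smul ?_ _
    exact hf.1.comp (continuous_pi fun j => continuous_apply _)
  exact ⟨h1, h2⟩

/-- The homogeneous differential on `C_b(G^{n+1}, E)^G`. -/
def cbDiff (n : ℕ) : cbCochains ρ n →L[ℝ] cbCochains ρ (n + 1) :=
  (diff (face n)).restrict (fun f hf => diff_mem_cbCochains ρ n f hf)

/-- The continuous bounded cohomology `H_cb^n(G, E)`. -/
abbrev Hcb (n : ℕ) : Type _ := Cohomology (cbDiff ρ) n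

end Cb

end LInf

/-! ### The tree, its automorphism group and coherent tuples -/

section Tree

variable {V : Type*} (T : SimpleGraph V)

/-- The automorphism group of a graph, with the topology of pointwise convergence on the discrete
set of vertices. -/
instance autTopology : TopologicalSpace (T ≃g T) :=
  TopologicalSpace.induced (fun (g : T ≃g T) (v : V) => g v)
    (@Pi.topologicalSpace V (fun _ => V) (fun _ => ⊥))

/-- A tuple is coherent if it is aligned, i.e. its entries lie on a geodesic segment (in a tree:
a path without repeated vertices), and its entries are distinct and listed in increasing order for
one of the two linear orders on the segment. Since a segment may be traversed in both directions,
it suffices to ask that they occur in increasing order along some path `p`. -/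
def IsCoherent {n : ℕ} (x : Fin n → V) : Prop :=
  ∃ (u v : V) (p : T.Walk u v), p.IsPath ∧
    ∃ k : Fin n → ℕ, StrictMono k ∧ ∀ i, k i ≤ p.length ∧ p.getVert (k i) = x i

/-- The set of coherent aligned `n`-tuples of vertices. -/
abbrev Coh (n : ℕ) : Type _ := {x : Fin n → V // IsCoherent T x}

variable {T}

theorem IsCoherent.comp {m n : ℕ} {x : Fin n → V} (hx : IsCoherent T x) {f : Fin m → Fin n}
    (hf : StrictMono f) : IsCoherent T (fun i => x (f i)) := by
  obtain ⟨u, v, p, hp, k, hk, h⟩ := hx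
  exact ⟨u, v, p, hp, fun i => k (f i), hk.comp hf, fun i => h (f i)⟩

theorem IsCoherent.rev {n : ℕ} {x : Fin n → V} (hx : IsCoherent T x) :
    IsCoherent T (fun i => x (Fin.revPerm i)) := by
  obtain ⟨u, v, p, hp, k, hk, h⟩ := hx
  refine ⟨v, u, p.reverse, hp.reverse, fun i => p.length - k (Fin.rev i), ?_, fun i => ?_⟩
  · intro i j hij
    have h1 := hk (Fin.rev_lt_rev.2 hij)
    have h2 := (h (Fin.rev i)).1
    have h3 := (h (Fin.rev j)).1
    have h4 := (h (Fin.rev i)).1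
    change p.length - k (Fin.rev i) < p.length - k (Fin.rev j)
    omega
  · have h2 := (h (Fin.rev i)).1
    refine ⟨by rw [SimpleGraph.Walk.length_reverse]; exact Nat.sub_le _ _, ?_⟩
    rw [SimpleGraph.Walk.getVert_reverse, Nat.sub_sub_self h2]
    exact (h (Fin.rev i)).2

theorem IsCoherent.map {n : ℕ} {x : Fin n → V} (hx : IsCoherent T x) (g : T ≃g T) :
    IsCoherent T (fun i => g (x i)) := by
  obtain ⟨u, v, p, hp, k, hk, h⟩ := hx
  refine ⟨_, _, p.map g.toHom, hp.map g.injective, k, hk,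
    fun i => ⟨by rw [SimpleGraph.Walk.length_map]; exact (h i).1, ?_⟩⟩
  rw [SimpleGraph.Walk.getVert_map, (h i).2]
  rfl

/-- Omission of the `i`-th entry of a coherent tuple. -/
def Coh.face (n : ℕ) (i : Fin (n + 2)) (x : Coh T (n + 2)) : Coh T (n + 1) :=
  ⟨AlignedCochains.face n i x.1, x.2.comp (Fin.strictMono_succAbove i)⟩

/-- Reversal `x ↦ x^τ` of a coherent tuple. -/
def Coh.rev {n : ℕ} (x : Coh T n) : Coh T n := ⟨fun i => x.1 (Fin.revPerm i), x.2.rev⟩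

/-- The action of `Aut(T)` on coherent tuples. -/
def Coh.act {n : ℕ} (g : T ≃g T) (x : Coh T n) : Coh T n := ⟨fun i => g (x.1 i), x.2.map g⟩

variable (T)
variable (E : Type*) [NormedAddCommGroup E] [NormedSpace ℝ E]

/-- The signature of the order-reversing permutation `τ_q` of `{0, …, q}`. -/
def revSign (q : ℕ) : ℝ := ((Equiv.Perm.sign (Fin.revPerm : Equiv.Perm (Fin (q + 1))) : ℤ) : ℝ)

theorem revSign_mul_self (q : ℕ) : revSign q * revSign q = 1 := by
  unfold revSign
  rw [← Int.cast_mul, ← Units.val_mul, Int.units_mul_self, Units.val_one, Int.cast_one]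

theorem revSign_succ (q : ℕ) : revSign (q + 1) = (-1) ^ (q + 1) * revSign q := by
  have key : ∀ n : ℕ, Equiv.Perm.sign (Fin.revPerm : Equiv.Perm (Fin n)) =
      ∏ j : Fin n, (-1) ^ (j : ℕ) := by
    intro n
    rw [Equiv.Perm.sign_eq_prod_prod_Iio]
    refine Finset.prod_congr rfl fun j _ => ?_
    rw [Finset.prod_congr rfl (g := fun _ => (-1 : ℤˣ))]
    · simp
    · intro i hi
      rw [Finset.mem_Iio] at hi
      rw [if_neg]
      simp only [Fin.revPerm_apply, Fin.rev_lt_rev, not_lt]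
      exact hi.le
  unfold revSign
  rw [key (q + 1 + 1), Fin.prod_univ_castSucc, key (q + 1)]
  simp [mul_comm]

/-- The involution `τ̂_q` of `ℓ^∞(coh^{q+1}, E)`: `(τ̂_q α)(x) = sign(τ_q) α(x^{τ_q})`. -/
def tauHat (q : ℕ) : LInf (Coh T (q + 1)) E →L[ℝ] LInf (Coh T (q + 1)) E :=
  revSign q • LInf.comp Coh.rev

/-- `ℓ^∞_+(coh^{q+1}, E)`: the `+1` eigenspace of `τ̂_q`. -/
def plus (q : ℕ) : Submodule ℝ (LInf (Coh T (q + 1)) E) where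
  carrier := {α | tauHat T E q α = α}
  zero_mem' := map_zero _
  add_mem' := fun {a b} ha hb => by
    change tauHat T E q (a + b) = a + b
    rw [map_add, ha, hb]
  smul_mem' := fun c a ha => by
    change tauHat T E q (c • a) = c • a
    rw [map_smul, ha]

/-- The differential of `ℓ^∞(coh^{q+1}, E)`. -/
abbrev cohDiff (q : ℕ) : LInf (Coh T (q + 1)) E →L[ℝ] LInf (Coh T (q + 2)) E :=
  diff (Coh.face q)

/-- The projection `A_q = (τ̂_q + Id) / 2`. -/
def projA (q : ℕ) : LInf (Coh T (q + 1)) E →L[ℝ] LInf (Coh T (q + 1)) E :=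
  (2⁻¹ : ℝ) • (tauHat T E q + ContinuousLinearMap.id ℝ _)

variable {E}

theorem tauHat_apply (q : ℕ) (α : LInf (Coh T (q + 1)) E) (x : Coh T (q + 1)) :
    tauHat T E q α x = revSign q • α x.rev := rfl

theorem tauHat_tauHat (q : ℕ) (α : LInf (Coh T (q + 1)) E) :
    tauHat T E q (tauHat T E q α) = α := by
  ext x
  rw [tauHat_apply, tauHat_apply, smul_smul, revSign_mul_self, one_smul]
  have h : x.rev.rev = x := by
    apply Subtype.ext
    funext i
    change x.1 (Fin.rev (Fin.rev i)) = x.1 i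
    rw [Fin.rev_rev]
  rw [h]

theorem tauHat_diff (q : ℕ) (α : LInf (Coh T (q + 1)) E) :
    tauHat T E (q + 1) (cohDiff T E q α) = cohDiff T E q (tauHat T E q α) := by
  ext x
  rw [tauHat_apply, diff_apply, diff_apply, Finset.smul_sum, ← Equiv.sum_comp Fin.revPerm]
  refine Finset.sum_congr rfl fun i _ => ?_
  have hf : Coh.face q (Fin.revPerm i) x.rev = (Coh.face q i x).rev := by
    apply Subtype.ext
    funext j
    change x.1 (Fin.rev ((Fin.rev i).succAbove j)) = x.1 (i.succAbove (Fin.rev j))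
    rw [Fin.rev_succAbove, Fin.rev_rev]
  rw [hf, tauHat_apply, smul_smul, smul_smul, revSign_succ]
  congr 1
  have hi : (q + 1) = (i : ℕ) + (Fin.revPerm i : Fin (q + 2)) := by
    rw [Fin.revPerm_apply, Fin.val_rev]; omega
  have hs : ((-1 : ℝ) ^ ((Fin.revPerm i : Fin (q + 2)) : ℕ)) *
      (-1) ^ ((Fin.revPerm i : Fin (q + 2)) : ℕ) = 1 := by
    rw [← mul_pow]; simp
  rw [hi, pow_add]
  linear_combination ((-1 : ℝ) ^ (i : ℕ) * revSign q) * hs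

theorem projA_mem (q : ℕ) (α : LInf (Coh T (q + 1)) E) : projA T E q α ∈ plus T E q := by
  change tauHat T E q ((2⁻¹ : ℝ) • (tauHat T E q α + α)) = (2⁻¹ : ℝ) • (tauHat T E q α + α)
  rw [map_smul, map_add, tauHat_tauHat]
  exact congrArg _ (add_comm _ _)

theorem projA_diff (q : ℕ) (α : LInf (Coh T (q + 1)) E) :
    projA T E (q + 1) (cohDiff T E q α) = cohDiff T E q (projA T E q α) := by
  change (2⁻¹ : ℝ) • (tauHat T E (q + 1) (cohDiff T E q α) + cohDiff T E q α) =
    cohDiff T E q ((2⁻¹ : ℝ) • (tauHat T E q α + α))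
  rw [tauHat_diff, map_smul, map_add]

theorem diff_mem_plus (q : ℕ) {α : LInf (Coh T (q + 1)) E} (hα : α ∈ plus T E q) :
    cohDiff T E q α ∈ plus T E (q + 1) := by
  change tauHat T E (q + 1) (cohDiff T E q α) = cohDiff T E q α
  have h : tauHat T E q α = α := hα
  rw [tauHat_diff, h]

variable (E)

/-- The differential `ℓ^∞_+(coh^{q+1}, E) → ℓ^∞_+(coh^{q+2}, E)`. -/
def plusDiff (q : ℕ) : plus T E q →L[ℝ] plus T E (q + 1) :=
  (cohDiff T E q).restrict (fun _ hα => diff_mem_plus T q hα)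

/-- The augmentation `E → ℓ^∞_+(coh^1, E)`, with values in the constant functions. -/
def plusAug : E →L[ℝ] plus T E 0 :=
  (LInf.const (Coh T 1)).codRestrict (plus T E 0) (fun e => by
    change tauHat T E 0 (LInf.const (Coh T 1) e) = LInf.const (Coh T 1) e
    ext x
    rw [tauHat_apply]
    have h : revSign 0 = 1 := by
      have : (Fin.revPerm : Equiv.Perm (Fin 1)) = 1 := Subsingleton.elim _ _
      unfold revSign
      rw [this, Equiv.Perm.sign_one, Units.val_one, Int.cast_one]
    rw [h, one_smul]
    rfl)

variable {E} {T}
variable (ρ : (T ≃g T) →* (E ≃ₗᵢ[ℝ] E))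

/-- The diagonal action of `Aut(T)` on `V^n`. -/
def vAct {n : ℕ} (g : T ≃g T) (x : Fin n → V) : Fin n → V := fun i => g (x i)

/-- `ℓ^∞(V^{q+1}, E)^{Aut(T)}`. -/
def vCochains (q : ℕ) : Submodule ℝ (LInf (Fin (q + 1) → V) E) :=
  equivariant ρ vAct

/-- The homogeneous differential of `ℓ^∞(V^{q+1}, E)^{Aut(T)}`. -/
def vDiff (q : ℕ) : vCochains ρ q →L[ℝ] vCochains ρ (q + 1) :=
  (diff (face q)).restrict (fun _ hα =>
    diff_mem_equivariant (actX := vAct) (actY := vAct) (fun _ _ _ => rfl) hα)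

/-- `ℓ^∞_+(coh^{q+1}, E)^{Aut(T)}`. -/
def plusInv (q : ℕ) : Submodule ℝ (LInf (Coh T (q + 1)) E) :=
  plus T E q ⊓ equivariant ρ Coh.act

/-- The differential of `ℓ^∞_+(coh^{q+1}, E)^{Aut(T)}`. -/
def plusInvDiff (q : ℕ) : plusInv ρ q →L[ℝ] plusInv ρ (q + 1) :=
  (cohDiff T E q).restrict (fun _ hα =>
    ⟨diff_mem_plus T q hα.1,
      diff_mem_equivariant (actX := Coh.act) (actY := Coh.act) (fun _ _ _ => rfl) hα.2⟩)

/-- The cohomology of `0 → ℓ^∞(V, E)^{Aut(T)} → ℓ^∞(V^2, E)^{Aut(T)} → ⋯`. -/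
abbrev HV (q : ℕ) : Type _ := Cohomology (vDiff ρ) q

/-- The cohomology of `0 → ℓ^∞_+(coh^1, E)^{Aut(T)} → ℓ^∞_+(coh^2, E)^{Aut(T)} → ⋯`. -/
abbrev HCoh (q : ℕ) : Type _ := Cohomology (plusInvDiff ρ) q

theorem continuous_orbit (v : V) (q : ℕ) {Z : Type*} [TopologicalSpace Z]
    (F : (Fin (q + 1) → V) → Z) :
    Continuous (fun g : Fin (q + 1) → (T ≃g T) => F (fun i => g i v)) := by
  let _ : TopologicalSpace V := ⊥
  have _ : DiscreteTopology V := ⟨rfl⟩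
  have h1 : Continuous (fun (g : T ≃g T) (w : V) => g w) := continuous_induced_dom
  exact (continuous_of_discreteTopology (f := F)).comp
    (continuous_pi fun i => ((continuous_apply v).comp h1).comp (continuous_apply i))

/-- The orbit map `ℓ^∞(V^{q+1}, E)^{Aut(T)} → C_b(Aut(T)^{q+1}, E)^{Aut(T)}` at a vertex `v`:
`α ↦ ((g₀, …, g_q) ↦ α (g₀ v, …, g_q v))`. -/
def orbitMap (v : V) (q : ℕ) : vCochains ρ q →L[ℝ] cbCochains ρ q :=
  (LInf.comp (fun (g : Fin (q + 1) → (T ≃g T)) i => g i v)).restrict (fun α hα =>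
    ⟨continuous_orbit v q (fun x => α x),
      comp_mem_equivariant (actX := mulTuple) (actY := vAct) (fun _ _ => rfl) hα⟩)

/-- The map `HV → H_cb(Aut(T), E)` induced by the orbit map at `v`. -/
def orbitH (v : V) (q : ℕ) : HV ρ q →L[ℝ] Hcb ρ q :=
  Cohomology.map (orbitMap ρ v) (fun n α => by
    ext g
    change LInf.comp _ (diff (face n) α.1) g = diff (face n) (LInf.comp _ α.1) g
    rw [LInf.comp_apply, diff_apply, diff_apply]
    rfl) q

/-- Restriction of bounded functions on `V^{q+1}` to coherent tuples. -/
abbrev rest (T : SimpleGraph V) (q : ℕ) : LInf (Fin (q + 1) → V) E →L[ℝ] LInf (Coh T (q + 1)) E :=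
  LInf.comp Subtype.val

theorem projA_mem_equivariant (q : ℕ) {α : LInf (Coh T (q + 1)) E}
    (hα : α ∈ equivariant ρ Coh.act) : projA T E q α ∈ equivariant ρ Coh.act :=
  Submodule.smul_mem _ _ (Submodule.add_mem _
    (Submodule.smul_mem _ _
      (comp_mem_equivariant (actX := Coh.act) (actY := Coh.act) (fun _ _ => rfl) hα)) hα)

/-- The map `A_q ∘ rest` on invariants. -/
def compMap (q : ℕ) : vCochains ρ q →L[ℝ] plusInv ρ q :=
  (projA T E q ∘L rest T q).restrict (fun _ hα =>
    ⟨projA_mem T q _, projA_mem_equivariant ρ q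
      (comp_mem_equivariant (actX := Coh.act) (actY := vAct) (fun _ _ => rfl) hα)⟩)

/-- The map induced by `A_q ∘ rest` on the cohomology of the invariants. -/
def compH (q : ℕ) : HV ρ q →L[ℝ] HCoh ρ q :=
  Cohomology.map (compMap ρ) (fun n α => by
    apply Subtype.ext
    change projA T E (n + 1) (rest T (n + 1) (diff (face n) α.1)) =
      cohDiff T E n (projA T E n (rest T n α.1))
    rw [← projA_diff]
    congr 1
    ext x
    rw [LInf.comp_apply, diff_apply, diff_apply]
    rfl) q

end Tree

end AlignedCochains

end

noncomputable section

namespace AlignedCochains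

/-! ### Metric geometry of trees -/

section TreeMetric

variable {V : Type*} {T : SimpleGraph V}

/-! An aligned tuple of distinct vertices has a coherent ordering (`Aligned.exists_perm`), unique up
to reversal (`IsCoherent.perm_eq`). Hence `antisym`, the signed average over coherent orderings, is
a projection on real chains that commutes with the boundary on aligned chains (`bd_antisym`); on
coherent chains it is dual to `A_q`.

Exactness comes from a bounded homotopy on chains. For a root `o`, `contraction` subtracts from a
tuple the contraction of its boundary and cones off the result from the meet of the entries in the
tree order rooted at `o`. The geometric input is `collinear_meet`: for an aligned tuple, the meet is
collinear with any two points of the hull of `o` and the tuple, so coning keeps chains aligned.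
Composing with `antisym` and dualising yields primitives of cocycles (`exists_primitive`).

For the invariants, the contraction rooted at the first entry of a tuple extends `antisym` from
coherent chains to an equivariant bounded chain map `coherentProj` from all chains to coherent ones.
Its dual inverts restriction followed by `A_q` on cohomology. For `H_cb`, local finiteness makes
vertex stabilisers compact and open, and Haar averages over their cosets give a bounded equivariant
cochain map `averaging` from functions on the group to functions on vertices, inverse to the orbit
map on cohomology.

One composite is the identity already on cochains (`compH_extendH`). The other three are treated by
one principle: a bounded cochain endomorphism that fixes constants, respects the group action and
preserves continuity with parameters is homotopic to the identity (`homotopy_codiff`). The homotopy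
freezes the first variable and recurses. All inverses are induced by bounded maps, so the
isomorphisms are topological even when cohomology is not Hausdorff. -/

theorem length_eq_dist (hT : T.IsTree) {u v : V} {p : T.Walk u v} (hp : p.IsPath) :
    p.length = T.dist u v := by
  obtain ⟨q, hq, hl⟩ := hT.connected.exists_path_of_dist u v
  have := (hT.isAcyclic.subsingleton_path u v).elim ⟨p, hp⟩ ⟨q, hq⟩
  rw [← hl]
  exact congrArg (fun r : T.Path u v => r.1.length) this

theorem dist_getVert (hT : T.IsTree) {u v : V} {p : T.Walk u v} (hp : p.IsPath) {i j : ℕ}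
    (hij : i ≤ j) (hj : j ≤ p.length) : T.dist (p.getVert i) (p.getVert j) = j - i := by
  have h := length_eq_dist hT ((hp.drop i).take (j - i))
  rw [SimpleGraph.Walk.take_length, SimpleGraph.Walk.drop_length,
    SimpleGraph.Walk.drop_getVert] at h
  rw [show i + (j - i) = j by omega] at h
  omega

/-- `b` lies on the geodesic from `a` to `c`. -/
def Btw (T : SimpleGraph V) (a b c : V) : Prop := T.dist a b + T.dist b c = T.dist a c

/-- Geodesics from `a` to `b` and from `b` to `c` concatenate to a walk of length `dist a c`, hence
to a path, and paths in a tree are unique. -/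
theorem Btw.eq_getVert (hT : T.IsTree) {a b c : V} (h : Btw T a b c) {p : T.Walk a c}
    (hp : p.IsPath) : p.getVert (T.dist a b) = b := by
  obtain ⟨q, -, hq⟩ := hT.connected.exists_path_of_dist a b
  obtain ⟨r, -, hr⟩ := hT.connected.exists_path_of_dist b c
  have hqr : (q.append r).IsPath := by
    apply SimpleGraph.Walk.isPath_of_length_eq_dist
    rw [SimpleGraph.Walk.length_append, hq, hr]
    exact h
  have := congrArg Subtype.val ((hT.isAcyclic.subsingleton_path a c).elim ⟨p, hp⟩ ⟨_, hqr⟩)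
  dsimp at this
  rw [this, SimpleGraph.Walk.getVert_append, hq]
  simp

theorem btw_getVert (hT : T.IsTree) {u v : V} {p : T.Walk u v} (hp : p.IsPath) {i : ℕ}
    (hi : i ≤ p.length) : Btw T u (p.getVert i) v := by
  have h1 := dist_getVert hT hp (Nat.zero_le i) hi
  have h2 := dist_getVert hT hp hi le_rfl
  have h3 := dist_getVert hT hp (Nat.zero_le _) le_rfl
  simp only [SimpleGraph.Walk.getVert_zero, SimpleGraph.Walk.getVert_length] at h1 h2 h3
  unfold Btw
  omega

/-- Two points of a geodesic from `o` are at distance the difference of their distances to `o`. -/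
theorem Btw.chain (hT : T.IsTree) {o x y z : V} (hx : Btw T o x z) (hy : Btw T o y z)
    (h : T.dist o x ≤ T.dist o y) : Btw T o x y := by
  obtain ⟨p, hp, hl⟩ := hT.connected.exists_path_of_dist o z
  have := dist_getVert hT hp h (by unfold Btw at hy; omega)
  rw [hx.eq_getVert hT hp, hy.eq_getVert hT hp] at this
  unfold Btw
  omega

/-- The set of points lying below all of the `x i`, in the tree order with root `o`, has a
greatest element. -/
theorem exists_meet (hT : T.IsTree) {ι : Type*} [Nonempty ι] (o : V) (x : ι → V) :
    ∃ m, (∀ i, Btw T o m (x i)) ∧ ∀ w, (∀ i, Btw T o w (x i)) → Btw T o w m := by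
  obtain ⟨i⟩ := ‹Nonempty ι›
  -- A common lower bound farthest from `o` is the greatest one: all of them lie on a single
  -- geodesic from `o` to `x i`, where distance to `o` decides the order.
  let S : Set ℕ := {k | ∃ m, (∀ i, Btw T o m (x i)) ∧ T.dist o m = k}
  have hS : S.Nonempty := ⟨0, o, fun i => by simp [Btw], by simp⟩
  have hb : BddAbove S := ⟨T.dist o (x i), by
    rintro _ ⟨m, hm, rfl⟩
    have := hm i
    unfold Btw at this
    omega⟩
  obtain ⟨m, hm, hk⟩ := Nat.sSup_mem hS hb
  exact ⟨m, hm, fun w hw => (hw i).chain hT (hm i) (by rw [hk]; exact le_csSup hb ⟨w, hw, rfl⟩)⟩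

theorem btw_antisymm (hT : T.IsTree) {o x y : V} (h : Btw T o x y) (h' : Btw T o y x) : x = y := by
  rw [← hT.connected.dist_eq_zero_iff]
  unfold Btw at *
  omega

theorem btw_comm {a b c : V} : Btw T a b c ↔ Btw T c b a := by
  unfold Btw
  rw [T.dist_comm (u := a) (v := b), T.dist_comm (u := b) (v := c), T.dist_comm (u := a) (v := c),
    add_comm]

/-- The median of three points of a tree. -/
theorem exists_median (hT : T.IsTree) (o x y : V) :
    ∃ m, Btw T o m x ∧ Btw T o m y ∧ Btw T x m y := by
  obtain ⟨m, hm, hmax⟩ := exists_meet hT o ![x, y]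
  have hx : Btw T o m x := hm 0
  have hy : Btw T o m y := hm 1
  refine ⟨m, hx, hy, ?_⟩
  obtain ⟨p, hp, hpl⟩ := hT.connected.exists_path_of_dist x m
  obtain ⟨q, hq, hql⟩ := hT.connected.exists_path_of_dist m y
  have hpq : (p.append q).IsPath := by
    rw [SimpleGraph.Walk.isPath_def, SimpleGraph.Walk.support_append, List.nodup_append']
    have hq' := (SimpleGraph.Walk.isPath_def q).1 hq
    rw [← SimpleGraph.Walk.cons_tail_support] at hq'
    rw [List.nodup_cons] at hq'
    refine ⟨(SimpleGraph.Walk.isPath_def p).1 hp, hq'.2, ?_⟩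
    -- A second common vertex `w` would lie on the geodesics from `o` to `x` and to `y`, strictly
    -- beyond `m`, against the maximality of `m`.
    intro w hw hw'
    have hwm : w ≠ m := fun h => hq'.1 (h ▸ hw')
    obtain ⟨i, rfl, hi⟩ := SimpleGraph.Walk.mem_support_iff_exists_getVert.1 hw
    have h1 := btw_getVert hT hp hi
    obtain ⟨j, hj', hj⟩ := SimpleGraph.Walk.mem_support_iff_exists_getVert.1
      (List.mem_of_mem_tail hw')
    have h2 := btw_getVert hT hq hj
    rw [hj'] at h2
    generalize p.getVert i = w at *
    have ht := hT.connected.dist_triangle (u := o) (v := w) (w := x)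
    have ht' := hT.connected.dist_triangle (u := o) (v := w) (w := y)
    have ht2 := hT.connected.dist_triangle (u := o) (v := m) (w := w)
    have hpos := hT.connected.pos_dist_of_ne hwm
    have c1 := T.dist_comm (u := x) (v := m)
    have c2 := T.dist_comm (u := x) (v := w)
    have c3 := T.dist_comm (u := w) (v := m)
    have hw1 : Btw T o w x := by unfold Btw at *; omega
    have hw2 : Btw T o w y := by unfold Btw at *; omega
    have := hmax w (fun i => by fin_cases i <;> assumption)
    unfold Btw at *
    omega
  have := length_eq_dist hT hpq
  rw [SimpleGraph.Walk.length_append, hpl, hql] at this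
  exact this

/-- The four point condition. -/
theorem four_point (hT : T.IsTree) (a b c e : V) :
    T.dist a b + T.dist c e ≤ T.dist a c + T.dist b e ∨
      T.dist a b + T.dist c e ≤ T.dist a e + T.dist b c := by
  -- Both medians lie on the geodesic from `a` to `b`. The one nearer to `a` also lies on the
  -- geodesics from `a` to `c` and to `e`, and `key` then bounds `dist c e`.
  obtain ⟨m, h1, h2, h3⟩ := exists_median hT a c b
  obtain ⟨n, k1, k2, k3⟩ := exists_median hT a b e
  have key : ∀ w, Btw T a w c → Btw T a w e →
      T.dist c e + 2 * T.dist a w ≤ T.dist a c + T.dist a e := by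
    intro w hc he
    have := hT.connected.dist_triangle (u := c) (v := w) (w := e)
    have c1 := T.dist_comm (u := c) (v := w)
    unfold Btw at *
    omega
  have d1 := T.dist_comm (u := m) (v := c)
  have d2 := T.dist_comm (u := n) (v := b)
  have d3 := T.dist_comm (u := b) (v := c)
  rcases le_total (T.dist a m) (T.dist a n) with h | h
  · have hc := h2.chain hT k1 h
    have he : Btw T a m e := by
      have := hT.connected.dist_triangle (u := a) (v := m) (w := e)
      have := hT.connected.dist_triangle (u := m) (v := n) (w := e)
      unfold Btw at *
      omega
    have := key m h1 he
    unfold Btw at *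
    omega
  · have hc := k1.chain hT h2 h
    have he : Btw T a n c := by
      have := hT.connected.dist_triangle (u := a) (v := n) (w := c)
      have := hT.connected.dist_triangle (u := n) (v := m) (w := c)
      unfold Btw at *
      omega
    have := key n he k2
    unfold Btw at *
    omega

theorem finite_sphere (hT : T.IsTree) (hlf : ∀ v, (T.neighborSet v).Finite) (v : V) (n : ℕ) :
    {w | T.dist v w = n}.Finite := by
  induction n with
  | zero =>
    refine (Set.finite_singleton v).subset fun w hw => ?_
    exact ((hT.connected.dist_eq_zero_iff).1 hw).symm
  | succ n ih =>
    refine (ih.biUnion fun u _ => hlf u).subset fun w hw => ?_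
    obtain ⟨p, hp, hl⟩ := hT.connected.exists_path_of_dist v w
    have hl' : p.length = n + 1 := hl.trans hw
    have h1 := dist_getVert hT hp (Nat.zero_le n) (by omega)
    have h2 := p.adj_getVert_succ (i := n) (by omega)
    rw [← hl', p.getVert_length] at h2
    rw [p.getVert_zero] at h1
    exact Set.mem_biUnion (show p.getVert n ∈ {w | T.dist v w = n} from h1) h2

/-- One of the three points lies between the two others. -/
def Collinear (T : SimpleGraph V) (a b c : V) : Prop := Btw T a b c ∨ Btw T b c a ∨ Btw T c a b

/-- All triples of entries of `x` are collinear; equivalently, the entries lie on a common geodesic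
segment. -/
def Aligned (T : SimpleGraph V) {ι : Type*} (x : ι → V) : Prop :=
  ∀ i j k, Collinear T (x i) (x j) (x k)

theorem Aligned.comp {ι κ : Type*} {x : ι → V} (hx : Aligned T x) (f : κ → ι) :
    Aligned T (fun i => x (f i)) := fun _ _ _ => hx _ _ _

theorem Collinear.rotate {a b c : V} (h : Collinear T a b c) : Collinear T b c a := by
  unfold Collinear at *; tauto

theorem Collinear.swap {a b c : V} (h : Collinear T a b c) : Collinear T b a c := by
  unfold Collinear at *
  rw [btw_comm (a := b), btw_comm (a := a) (b := c), btw_comm (b := b)]; tauto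

theorem collinear_self (a b : V) : Collinear T a a b := by
  left; simp [Btw]

theorem aligned_cons {n : ℕ} {x : Fin n → V} (hx : Aligned T x) (m : V)
    (h : ∀ i j, Collinear T m (x i) (x j)) : Aligned T (Fin.cons m x : Fin (n + 1) → V) := by
  intro i j k
  cases i using Fin.cases with
  | zero =>
    cases j using Fin.cases with
    | zero => exact collinear_self _ _
    | succ j =>
      cases k using Fin.cases with
      | zero => exact (collinear_self m (x j)).rotate
      | succ k => exact h j k
  | succ i =>
    cases j using Fin.cases with
    | zero =>
      cases k using Fin.cases with
      | zero => exact (collinear_self m (x i)).rotate.rotate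
      | succ k => exact (h i k).swap
    | succ j =>
      cases k using Fin.cases with
      | zero => exact (h i j).rotate
      | succ k => exact hx i j k

/-- The greatest lower bound of the entries of `x` in the tree order with root `o`. -/
def meet (hT : T.IsTree) {n : ℕ} (o : V) (x : Fin (n + 1) → V) : V := (exists_meet hT o x).choose

theorem meet_btw (hT : T.IsTree) {n : ℕ} (o : V) (x : Fin (n + 1) → V) (i : Fin (n + 1)) :
    Btw T o (meet hT o x) (x i) := (exists_meet hT o x).choose_spec.1 i

theorem btw_meet (hT : T.IsTree) {n : ℕ} {o : V} {x : Fin (n + 1) → V} {w : V}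
    (hw : ∀ i, Btw T o w (x i)) : Btw T o w (meet hT o x) := (exists_meet hT o x).choose_spec.2 w hw

/-! ### Equivariance of distances, betweenness and meets -/

theorem dist_map (hT : T.IsTree) (g : T ≃g T) (a b : V) : T.dist (g a) (g b) = T.dist a b := by
  have key : ∀ (g : T ≃g T) (a b : V), T.dist (g a) (g b) ≤ T.dist a b := by
    intro g a b
    obtain ⟨p, -, hl⟩ := hT.connected.exists_path_of_dist a b
    rw [← hl, ← SimpleGraph.Walk.length_map g.toHom p]
    exact SimpleGraph.dist_le _
  apply le_antisymm (key g a b)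
  have := key g.symm (g a) (g b)
  simpa using this

theorem btw_map (hT : T.IsTree) (g : T ≃g T) {a b c : V} :
    Btw T (g a) (g b) (g c) ↔ Btw T a b c := by
  unfold Btw; simp only [dist_map hT]

/-- The tree order determines the meet uniquely, and `g` carries the order rooted at `o` to the one
rooted at `g o`; the choice made in `meet` is therefore harmless. -/
theorem meet_map (hT : T.IsTree) (g : T ≃g T) {n : ℕ} (o : V) (x : Fin (n + 1) → V) :
    meet hT (g o) (fun i => g (x i)) = g (meet hT o x) := by
  apply btw_antisymm hT (o := g o)
  · obtain ⟨w, hw⟩ := g.surjective (meet hT (g o) (fun i => g (x i)))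
    rw [← hw, btw_map hT]
    apply btw_meet
    intro i
    rw [← btw_map hT g, hw]
    exact meet_btw hT (g o) (fun i => g (x i)) i
  · apply btw_meet
    intro i
    rw [btw_map hT]
    exact meet_btw hT o x i

theorem Btw.trans (hT : T.IsTree) {o a b c : V} (h : Btw T o a b) (h' : Btw T o b c) :
    Btw T o a c := by
  have := hT.connected.dist_triangle (u := o) (v := a) (w := c)
  have := hT.connected.dist_triangle (u := a) (v := b) (w := c)
  unfold Btw at *
  omega

theorem Btw.of_le (hT : T.IsTree) {o a b c : V} (h : Btw T o a b) (h' : Btw T o b c) :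
    Btw T a b c := by
  have := hT.connected.dist_triangle (u := o) (v := a) (w := c)
  have := hT.connected.dist_triangle (u := a) (v := b) (w := c)
  unfold Btw at *
  omega

/-- Two geodesics overlapping in a nondegenerate segment glue to a geodesic: positivity of `dist w
y` excludes the other alternative of the four point condition. -/
theorem Btw.extend (hT : T.IsTree) {a y w z : V} (h : Btw T a y w) (h' : Btw T y w z)
    (hne : 0 < T.dist w y) : Btw T a w z := by
  have h4 := four_point hT a w y z
  have := hT.connected.dist_triangle (u := a) (v := w) (w := z)
  have c1 := T.dist_comm (u := w) (v := y)
  unfold Btw at *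
  omega

/-- If the points `x i` are aligned, then their meet is collinear with any two points of the hull
of `o` and the `x i`. -/
theorem collinear_meet (hT : T.IsTree) {n : ℕ} {o : V} {x : Fin (n + 1) → V} (hx : Aligned T x)
    {y z : V} {i j : Fin (n + 1)} (hy : Btw T o y (x i)) (hz : Btw T o z (x j)) :
    Collinear T (meet hT o x) y z := by
  have hmx := meet_btw hT o x
  have hmw := fun w => btw_meet hT (o := o) (x := x) (w := w)
  generalize meet hT o x = m at *
  have chain_case : ∀ {y z : V}, Btw T o y z → (Btw T o y m ∧ Btw T o z m ∨ Btw T o m y) →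
      Collinear T m y z := by
    intro y z h h'
    rcases h' with ⟨h1, h2⟩ | h1
    · exact Or.inr (Or.inl (h.of_le hT h2))
    · exact Or.inl (h1.of_le hT h)
  rcases le_total (T.dist o y) (T.dist o m) with hym | hym
  · have hym := hy.chain hT (hmx i) hym
    rcases le_total (T.dist o z) (T.dist o m) with hzm | hzm
    · have hzm := hz.chain hT (hmx j) hzm
      rcases le_total (T.dist o y) (T.dist o z) with h | h
      · exact chain_case (hym.chain hT hzm h) (Or.inl ⟨hym, hzm⟩)
      · exact (chain_case (hzm.chain hT hym h) (Or.inl ⟨hzm, hym⟩)).swap.rotate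
    · have hzm := (hmx j).chain hT hz hzm
      exact Or.inr (Or.inr (btw_comm.1 (hym.of_le hT hzm)))
  have hym := (hmx i).chain hT hy hym
  rcases le_total (T.dist o z) (T.dist o m) with hzm | hzm
  · have hzm := hz.chain hT (hmx j) hzm
    exact Or.inr (Or.inr (hzm.of_le hT hym))
  have hzm := (hmx j).chain hT hz hzm
  -- Both `y` and `z` are now beyond `m`, and `w` is where the geodesics from `o` to them part. If
  -- `w` is no farther than `m`, then `m` lies between `y` and `z`.
  obtain ⟨w, wy, wz, wyz⟩ := exists_median hT o y z
  rcases le_or_gt (T.dist o w) (T.dist o m) with hwm | hwm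
  · have h := wy.chain hT hym hwm
    have h1 := h.of_le hT hym
    have h2 := h.of_le hT hzm
    have := hT.connected.dist_triangle (u := y) (v := m) (w := z)
    have c1 := T.dist_comm (u := y) (v := m)
    have c2 := T.dist_comm (u := z) (v := m)
    have c3 := T.dist_comm (u := y) (v := w)
    have c4 := T.dist_comm (u := y) (v := z)
    refine Or.inr (Or.inr ?_)
    unfold Btw at *
    omega
  -- Strictly beyond the meet, `w` is not a common lower bound, so some `x s` branches off before
  -- `w`.
  · have hs : ∃ s, ¬ Btw T o w (x s) := by
      by_contra! hcon
      have := hmw w hcon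
      unfold Btw at *
      omega
    obtain ⟨s, hs⟩ := hs
    rcases Nat.eq_zero_or_pos (T.dist w y) with hy0 | hy0
    · rw [hT.connected.dist_eq_zero_iff] at hy0
      subst hy0
      exact chain_case wz (Or.inr hym)
    rcases Nat.eq_zero_or_pos (T.dist w z) with hz0 | hz0
    · rw [hT.connected.dist_eq_zero_iff] at hz0
      subst hz0
      exact (chain_case wy (Or.inr hzm)).swap.rotate
    -- Now `w` differs from `y` and `z`, and `x i`, `x j`, `x s` lie in three different branches at
    -- `w`, each at positive distance from it. Such a triple is not collinear.
    exfalso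
    have ha := btw_comm.1 (wy.of_le hT hy)
    have hb := btw_comm.1 (wz.of_le hT hz)
    have e1 := ha.extend hT wyz hy0
    have e2 := hb.extend hT (btw_comm.1 e1) hz0
    have wa := wy.trans hT hy
    have wb := wz.trans hT hz
    have hcol := hx i j s
    have t := hT.connected.dist_triangle (u := o) (v := w) (w := x s)
    -- The other alternative of the four point condition would put `w` on the geodesic from `o` to
    -- `x s`.
    have key : ∀ {a}, Btw T o w a → Btw T a w (x s) := by
      intro a h
      have h4 := four_point hT a o (x s) w
      have t' := hT.connected.dist_triangle (u := a) (v := w) (w := x s)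
      have c1 := T.dist_comm (u := a) (v := o)
      have c2 := T.dist_comm (u := a) (v := w)
      have c3 := T.dist_comm (u := x s) (v := w)
      have c4 := T.dist_comm (u := x s) (v := o)
      unfold Btw at *
      omega
    have k1 := key wa
    have k2 := key wb
    have hwa : 0 < T.dist w (x i) := by
      have := wy.of_le hT hy
      unfold Btw at *; omega
    have hwb : 0 < T.dist w (x j) := by
      have := wz.of_le hT hz
      unfold Btw at *; omega
    have hwc : 0 < T.dist w (x s) := by
      refine hT.connected.pos_dist_of_ne fun h => hs ?_
      rw [← h]
      simp [Btw]
    have c1 := T.dist_comm (u := x i) (v := w)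
    have c2 := T.dist_comm (u := x j) (v := w)
    have c3 := T.dist_comm (u := x s) (v := w)
    have c4 := T.dist_comm (u := x i) (v := x j)
    have c5 := T.dist_comm (u := x i) (v := x s)
    have c6 := T.dist_comm (u := x j) (v := x s)
    unfold Collinear Btw at *
    omega

end TreeMetric

/-! ### Coherent tuples in metric terms -/

section CoherentMetric

variable {V : Type*} {T : SimpleGraph V}

theorem IsCoherent.exists_dist_eq (hT : T.IsTree) {n : ℕ} {x : Fin n → V} (hx : IsCoherent T x) :
    ∃ k : Fin n → ℕ, StrictMono k ∧ ∀ i j, i ≤ j → T.dist (x i) (x j) + k i = k j := by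
  obtain ⟨u, v, p, hp, k, hk, h⟩ := hx
  refine ⟨k, hk, fun i j hij => ?_⟩
  have := dist_getVert hT hp (hk.monotone hij) (h j).1
  rw [(h i).2, (h j).2] at this
  have := hk.monotone hij
  omega

theorem IsCoherent.injective (hT : T.IsTree) {n : ℕ} {x : Fin n → V} (hx : IsCoherent T x) :
    Function.Injective x := by
  obtain ⟨k, hk, h⟩ := hx.exists_dist_eq hT
  have key : ∀ i j, i < j → x i ≠ x j := by
    intro i j hij he
    have h1 := h i j hij.le
    have := hk hij
    rw [he, SimpleGraph.dist_self] at h1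
    omega
  intro i j hij
  by_contra hne
  rcases lt_or_gt_of_ne hne with h' | h'
  · exact key i j h' hij
  · exact key j i h' hij.symm

theorem IsCoherent.aligned (hT : T.IsTree) {n : ℕ} {x : Fin n → V} (hx : IsCoherent T x) :
    Aligned T x := by
  obtain ⟨k, hk, h⟩ := hx.exists_dist_eq hT
  have key : ∀ a b c, a ≤ b → b ≤ c → Btw T (x a) (x b) (x c) := by
    intro a b c hab hbc
    have h1 := h a b hab
    have h2 := h b c hbc
    have h3 := h a c (hab.trans hbc)
    unfold Btw
    omega
  intro a b c
  rcases le_total a b with h1 | h1 <;> rcases le_total b c with h2 | h2 <;>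
    rcases le_total a c with h3 | h3
  · exact Or.inl (key _ _ _ h1 h2)
  · exact Or.inl (key _ _ _ h1 h2)
  · exact Or.inr (Or.inl (btw_comm.1 (key _ _ _ h3 h2)))
  · exact Or.inr (Or.inr (key _ _ _ h3 h1))
  · exact Or.inr (Or.inr (btw_comm.1 (key _ _ _ h1 h3)))
  · exact Or.inr (Or.inl (key _ _ _ h2 h3))
  · exact Or.inl (btw_comm.1 (key _ _ _ h2 h1))
  · exact Or.inl (btw_comm.1 (key _ _ _ h2 h1))

theorem isCoherent_of_strictMono (hT : T.IsTree) {n : ℕ} {x : Fin n → V} {a b : V}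
    (hx : ∀ i, Btw T a (x i) b) (hm : StrictMono fun i => T.dist a (x i)) : IsCoherent T x := by
  obtain ⟨p, hp, hl⟩ := hT.connected.exists_path_of_dist a b
  refine ⟨a, b, p, hp, _, hm, fun i => ⟨?_, (hx i).eq_getVert hT hp⟩⟩
  have := hx i
  unfold Btw at this
  omega

theorem Aligned.exists_perm (hT : T.IsTree) {n : ℕ} {x : Fin (n + 1) → V} (hx : Aligned T x)
    (hi : Function.Injective x) :
    ∃ σ : Equiv.Perm (Fin (n + 1)), IsCoherent T (fun i => x (σ i)) := by
  -- A pair at maximal distance spans the tuple: collinearity then forces every entry between the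
  -- two, and sorting by distance to `x a` orders them along the geodesic.
  obtain ⟨⟨a, b⟩, hab⟩ :=
    Finite.exists_max (fun ij : Fin (n + 1) × Fin (n + 1) => T.dist (x ij.1) (x ij.2))
  have hB : ∀ i, Btw T (x a) (x i) (x b) := by
    intro i
    have h1 := hab (a, i)
    have h2 := hab (i, b)
    have h3 := hx a b i
    have c1 := T.dist_comm (u := x i) (v := x a)
    have c2 := T.dist_comm (u := x b) (v := x a)
    have c3 := T.dist_comm (u := x i) (v := x b)
    dsimp only at h1 h2
    unfold Collinear Btw at *
    omega
  have hinj : Function.Injective fun i => T.dist (x a) (x i) := by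
    intro i j hij
    dsimp only at hij
    exact hi (btw_antisymm hT ((hB i).chain hT (hB j) hij.le) ((hB j).chain hT (hB i) hij.ge))
  refine ⟨Tuple.sort fun i => T.dist (x a) (x i), isCoherent_of_strictMono hT (fun i => hB _) ?_⟩
  exact (Tuple.monotone_sort fun i => T.dist (x a) (x i)).strictMono_of_injective
    (hinj.comp (Equiv.injective _))

/-- The positions `k ∘ σ` and `l` describe the same finite metric space on a line, and such
positions agree up to translation and reflection. -/
theorem IsCoherent.perm_eq (hT : T.IsTree) {n : ℕ} {x : Fin (n + 1) → V} (hx : IsCoherent T x)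
    {σ : Equiv.Perm (Fin (n + 1))} (hσ : IsCoherent T (fun i => x (σ i))) :
    σ = 1 ∨ σ = Fin.revPerm := by
  obtain ⟨k, hk, h⟩ := hx.exists_dist_eq hT
  obtain ⟨l, hl, h'⟩ := hσ.exists_dist_eq hT
  -- One of the two truncated differences is zero, so their sum is the absolute value of the
  -- difference of `k (σ i)` and `k (σ j)`.
  have habs : ∀ i j, i ≤ j → l j = l i + (k (σ j) - k (σ i)) + (k (σ i) - k (σ j)) := by
    intro i j hij
    have h1 := h' i j hij
    rcases le_total (σ i) (σ j) with h2 | h2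
    · have := h _ _ h2
      have := hk.monotone h2
      omega
    · have := h _ _ h2
      have c := T.dist_comm (u := x (σ i)) (v := x (σ j))
      have := hk.monotone h2
      omega
  -- The distance between the end entries is the sum of the intermediate steps, so no step goes
  -- backwards; the direction of the total displacement selects the identity or the reversal.
  rcases le_total (k (σ 0)) (k (σ (Fin.last n))) with hd | hd
  · left
    have : StrictMono σ := by
      intro i j hij
      rw [← hk.lt_iff_lt]
      have h1 := habs 0 i (Fin.zero_le _)
      have h2 := habs 0 j (Fin.zero_le _)
      have h3 := habs i (Fin.last n) (Fin.le_last _)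
      have h4 := habs j (Fin.last n) (Fin.le_last _)
      have h5 := habs 0 (Fin.last n) (Fin.le_last _)
      have h6 := habs i j hij.le
      have h7 := hl hij
      omega
    ext i
    have h1 := congrFun (this.range_inj strictMono_id |>.1 (by simp)) i
    simp [h1]
  · right
    have : StrictMono (fun i => Fin.rev (σ i)) := by
      intro i j hij
      rw [Fin.rev_lt_rev, ← hk.lt_iff_lt]
      have h1 := habs 0 i (Fin.zero_le _)
      have h2 := habs 0 j (Fin.zero_le _)
      have h3 := habs i (Fin.last n) (Fin.le_last _)
      have h4 := habs j (Fin.last n) (Fin.le_last _)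
      have h5 := habs 0 (Fin.last n) (Fin.le_last _)
      have h6 := habs i j hij.le
      have h7 := hl hij
      omega
    ext i
    have hsurj : Function.Surjective (fun i => Fin.rev (σ i)) :=
      Fin.rev_surjective.comp σ.surjective
    have h1 := congrFun (this.range_inj strictMono_id |>.1 (by simp [hsurj.range_eq])) i
    dsimp at h1
    rw [Fin.revPerm_apply, ← h1, Fin.rev_rev, h1]

end CoherentMetric

/-! ### Faces of permuted tuples -/

/-- The permutation induced by `σ` on the complements of `j` and `σ j`. -/
theorem exists_perm_succAbove {n : ℕ} (σ : Equiv.Perm (Fin (n + 1))) (j : Fin (n + 1)) :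
    ∃ s : Equiv.Perm (Fin n), (∀ k, σ (j.succAbove k) = (σ j).succAbove (s k)) ∧
      (((-1 : ℤˣ) ^ (j : ℕ)) * Equiv.Perm.sign s = (-1) ^ (σ j : ℕ) * Equiv.Perm.sign σ) := by
  -- Cycles moving `j` and `σ j` to the front turn `σ` into a permutation fixing `0`; these cycles
  -- have signs `(-1) ^ j` and `(-1) ^ (σ j)`.
  let ω : Equiv.Perm (Fin (n + 1)) := (σ j).cycleRange * σ * (j.cycleRange)⁻¹
  have h0 : ω 0 = 0 := by simp [ω, Equiv.Perm.inv_def]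
  obtain ⟨⟨p, s⟩, hs⟩ := Equiv.Perm.decomposeFin.symm.surjective ω
  have hp : p = 0 := by
    rw [← Equiv.Perm.decomposeFin_symm_apply_zero p s, hs, h0]
  subst hp
  refine ⟨s, fun k => ?_, ?_⟩
  · have h1 : ω k.succ = (s k).succ := by
      rw [← hs, Equiv.Perm.decomposeFin_symm_apply_succ]
      simp
    rw [← Fin.cycleRange_symm_succ, ← Fin.cycleRange_symm_succ, ← h1]
    simp [ω, Equiv.Perm.inv_def]
  · have h1 : Equiv.Perm.sign ω = Equiv.Perm.sign s := by
      rw [← hs, Equiv.Perm.decomposeFin.symm_sign]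
      simp
    rw [← h1]
    simp only [ω, map_mul, map_inv, Fin.sign_cycleRange]
    have : ((-1 : ℤˣ) ^ (j : ℕ))⁻¹ = (-1) ^ (j : ℕ) := by
      rw [← inv_pow]; simp
    rw [this]
    have h2 : ((-1 : ℤˣ) ^ (j : ℕ)) * (-1) ^ (j : ℕ) = 1 := by rw [← mul_pow]; simp
    rw [mul_comm, mul_assoc, h2, mul_one]

/-! ### Real chains on tuples of vertices -/

section Chains

variable {V : Type*} {T : SimpleGraph V}

/-- Real chains on `(q + 1)`-tuples. -/
abbrev Chain (V : Type*) (q : ℕ) : Type _ := (Fin (q + 1) → V) →₀ ℝ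

/-- The basis chain given by a tuple. -/
abbrev simplex {q : ℕ} (x : Fin (q + 1) → V) : Chain V q := Finsupp.single x 1

/-- A linear map sends chains supported on `P` to `N` if it does so for simplices. -/
theorem mem_of_supported {M : Type*} [AddCommGroup M] [Module ℝ M] {q : ℕ}
    {P : Set (Fin (q + 1) → V)} (L : Chain V q →ₗ[ℝ] M) (N : Submodule ℝ M)
    (h : ∀ x ∈ P, L (simplex x) ∈ N) {z : Chain V q} (hz : z ∈ Finsupp.supported ℝ ℝ P) :
    L z ∈ N := by
  rw [Finsupp.supported_eq_span_single] at hz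
  have : Submodule.span ℝ ((fun i => Finsupp.single i (1 : ℝ)) '' P) ≤ N.comap L := by
    rw [Submodule.span_le]
    rintro _ ⟨x, hx, rfl⟩
    exact h x hx
  exact this hz

theorem eq_of_supported {M : Type*} [AddCommGroup M] [Module ℝ M] {q : ℕ}
    {P : Set (Fin (q + 1) → V)} {L L' : Chain V q →ₗ[ℝ] M}
    (h : ∀ x ∈ P, L (simplex x) = L' (simplex x)) {z : Chain V q}
    (hz : z ∈ Finsupp.supported ℝ ℝ P) : L z = L' z := by
  have := mem_of_supported (L - L') ⊥ (fun x hx => by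
    rw [Submodule.mem_bot, LinearMap.sub_apply, h x hx, sub_self]) hz
  rwa [Submodule.mem_bot, LinearMap.sub_apply, sub_eq_zero] at this

theorem chain_ext {M : Type*} [AddCommGroup M] [Module ℝ M] {q : ℕ}
    {L L' : Chain V q →ₗ[ℝ] M} (h : ∀ x, L (simplex x) = L' (simplex x)) : L = L' :=
  Finsupp.lhom_ext' fun x => LinearMap.ext_ring (h x)

/-- The linear extension of a map defined on simplices. -/
def lift {M : Type*} [AddCommGroup M] [Module ℝ M] {q : ℕ} (f : (Fin (q + 1) → V) → M) :
    Chain V q →ₗ[ℝ] M := Finsupp.linearCombination ℝ f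

@[simp] theorem lift_simplex {M : Type*} [AddCommGroup M] [Module ℝ M] {q : ℕ}
    (f : (Fin (q + 1) → V) → M) (x : Fin (q + 1) → V) : lift f (simplex x) = f x := by
  simp [lift]

/-- The homogeneous boundary. -/
def bd (q : ℕ) : Chain V (q + 1) →ₗ[ℝ] Chain V q :=
  lift fun x => ∑ i : Fin (q + 2), ((-1 : ℝ) ^ (i : ℕ)) • simplex (face q i x)

theorem bd_simplex {q : ℕ} (x : Fin (q + 2) → V) :
    bd q (simplex x) = ∑ i : Fin (q + 2), ((-1 : ℝ) ^ (i : ℕ)) • simplex (face q i x) :=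
  lift_simplex _ _

/-- Adjunction of an initial vertex. -/
def cone (q : ℕ) (m : V) : Chain V q →ₗ[ℝ] Chain V (q + 1) :=
  lift fun x => simplex (Fin.cons m x)

@[simp] theorem cone_simplex {q : ℕ} (m : V) (x : Fin (q + 1) → V) :
    cone q m (simplex x) = simplex (Fin.cons m x) := lift_simplex _ _

/-- The augmentation. -/
def aug : Chain V 0 →ₗ[ℝ] ℝ := lift fun _ => 1

@[simp] theorem aug_simplex (x : Fin 1 → V) : aug (simplex x) = 1 := lift_simplex _ _

theorem face_zero_cons {Y : Type*} {q : ℕ} (m : Y) (x : Fin (q + 1) → Y) :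
    face q 0 (Fin.cons m x) = x := by
  funext j
  simp [face]

theorem face_succ_cons {Y : Type*} {q : ℕ} (m : Y) (x : Fin (q + 2) → Y) (i : Fin (q + 2)) :
    face (q + 1) i.succ (Fin.cons m x) = Fin.cons m (face q i x) := by
  funext j
  cases j using Fin.cases <;> simp [face]

theorem face_one_cons {Y : Type*} (m : Y) (x : Fin 1 → Y) (i : Fin 1) :
    face 0 i.succ (Fin.cons m x) = fun _ => m := by
  funext j
  have _ : Subsingleton (Fin (0 + 1)) := inferInstanceAs (Subsingleton (Fin 1))
  have hj : j = 0 := Subsingleton.elim _ _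
  have hi : i = 0 := Subsingleton.elim _ _
  subst hj hi
  simp [face]

theorem bd_cone_zero (m : V) (z : Chain V 0) :
    bd 0 (cone 0 m z) = z - aug z • simplex (fun _ => m) := by
  have : bd 0 ∘ₗ cone 0 m = LinearMap.id - aug.smulRight (simplex (fun _ => m)) := by
    refine chain_ext fun x => ?_
    simp only [LinearMap.comp_apply, cone_simplex, bd_simplex, Fin.sum_univ_succ (n := 1),
      face_zero_cons, LinearMap.sub_apply, LinearMap.id_apply, LinearMap.smulRight_apply,
      aug_simplex, face_one_cons]
    simp [sub_eq_add_neg]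
  exact LinearMap.congr_fun this z

theorem bd_cone (q : ℕ) (m : V) (z : Chain V (q + 1)) :
    bd (q + 1) (cone (q + 1) m z) = z - cone q m (bd q z) := by
  have : bd (q + 1) ∘ₗ cone (q + 1) m = LinearMap.id - cone q m ∘ₗ bd q := by
    refine chain_ext fun x => ?_
    simp only [LinearMap.comp_apply, cone_simplex, bd_simplex, Fin.sum_univ_succ (n := q + 2),
      face_zero_cons, LinearMap.sub_apply, LinearMap.id_apply, face_succ_cons, map_sum, map_smul]
    simp [pow_succ, sub_eq_add_neg, Finset.sum_neg_distrib]
  exact LinearMap.congr_fun this z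

theorem aug_bd (z : Chain V 1) : aug (bd 0 z) = 0 := by
  have : aug ∘ₗ bd 0 = (0 : Chain V 1 →ₗ[ℝ] ℝ) := by
    refine chain_ext fun x => ?_
    simp [bd_simplex, Fin.sum_univ_succ]
  exact LinearMap.congr_fun this z

/-- Every simplex here is a cone over its tail, so the cone formula gives an induction on degree
that avoids cancelling a double sum. -/
theorem bd_bd (q : ℕ) (z : Chain V (q + 2)) : bd q (bd (q + 1) z) = 0 := by
  have : bd q ∘ₗ bd (q + 1) = (0 : Chain V (q + 2) →ₗ[ℝ] Chain V q) := by
    clear z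
    induction q with
    | zero =>
      refine chain_ext fun x => ?_
      obtain ⟨m, y, rfl⟩ : ∃ m y, x = Fin.cons m y := ⟨x 0, Fin.tail x, (Fin.cons_self_tail x).symm⟩
      rw [LinearMap.comp_apply, ← cone_simplex, bd_cone, map_sub, bd_cone_zero, aug_bd]
      simp
    | succ q ih =>
      refine chain_ext fun x => ?_
      obtain ⟨m, y, rfl⟩ : ∃ m y, x = Fin.cons m y := ⟨x 0, Fin.tail x, (Fin.cons_self_tail x).symm⟩
      have h := LinearMap.congr_fun ih (simplex y)
      rw [LinearMap.comp_apply] at h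
      rw [LinearMap.comp_apply, ← cone_simplex, bd_cone, map_sub, bd_cone, h]
      simp
  exact LinearMap.congr_fun this z

/-- The action of an automorphism on chains. -/
def chainAct (q : ℕ) (g : T ≃g T) : Chain V q →ₗ[ℝ] Chain V q := lift fun x => simplex (vAct g x)

@[simp] theorem chainAct_simplex {q : ℕ} (g : T ≃g T) (x : Fin (q + 1) → V) :
    chainAct q g (simplex x) = simplex (vAct g x) := lift_simplex _ _

theorem vAct_cons {q : ℕ} (g : T ≃g T) (m : V) (x : Fin q → V) :
    vAct g (Fin.cons m x : Fin (q + 1) → V) = Fin.cons (g m) (vAct g x) := by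
  funext j
  cases j using Fin.cases <;> rfl

theorem chainAct_cone {q : ℕ} (g : T ≃g T) (m : V) (z : Chain V q) :
    chainAct (q + 1) g (cone q m z) = cone q (g m) (chainAct q g z) := by
  have : chainAct (q + 1) g ∘ₗ cone q m = cone q (g m) ∘ₗ chainAct q g :=
    chain_ext fun x => by simp [vAct_cons]
  exact LinearMap.congr_fun this z

theorem chainAct_bd {q : ℕ} (g : T ≃g T) (z : Chain V (q + 1)) :
    chainAct q g (bd q z) = bd q (chainAct (q + 1) g z) := by
  have : chainAct q g ∘ₗ bd q = bd q ∘ₗ chainAct (q + 1) g := by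
    refine chain_ext fun x => ?_
    simp only [LinearMap.comp_apply, bd_simplex, chainAct_simplex, map_sum, map_smul]
    rfl
  exact LinearMap.congr_fun this z

/-! ### Bounds -/

section Bounds

variable (E : Type*) [NormedAddCommGroup E] [NormedSpace ℝ E]

/-- Evaluating at `z` a function bounded by `K` gives a vector of norm at most `C * K`. -/
def BoundedBy {q : ℕ} (C : ℝ) (z : Chain V q) : Prop :=
  ∀ (α : (Fin (q + 1) → V) → E) (K : ℝ), (∀ x, ‖α x‖ ≤ K) → ‖lift α z‖ ≤ C * K

variable {E}

theorem boundedBy_simplex {q : ℕ} (x : Fin (q + 1) → V) : BoundedBy E 1 (simplex x) := by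
  intro α K h
  rw [lift_simplex, one_mul]
  exact h x

theorem BoundedBy.smul {q : ℕ} {C : ℝ} {z : Chain V q} (h : BoundedBy E C z) (c : ℝ) :
    BoundedBy E (|c| * C) (c • z) := by
  intro α K hK
  rw [map_smul, norm_smul, mul_assoc, Real.norm_eq_abs]
  exact mul_le_mul_of_nonneg_left (h α K hK) (abs_nonneg c)

theorem BoundedBy.sub {q : ℕ} {C C' : ℝ} {z z' : Chain V q} (h : BoundedBy E C z)
    (h' : BoundedBy E C' z') : BoundedBy E (C + C') (z - z') := by
  intro α K hK
  rw [map_sub, add_mul]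
  exact (norm_sub_le _ _).trans (add_le_add (h α K hK) (h' α K hK))

theorem BoundedBy.sum {q : ℕ} {ι : Type*} (s : Finset ι) {C : ι → ℝ} {z : ι → Chain V q}
    (h : ∀ i ∈ s, BoundedBy E (C i) (z i)) : BoundedBy E (∑ i ∈ s, C i) (∑ i ∈ s, z i) := by
  intro α K hK
  rw [map_sum, Finset.sum_mul]
  exact norm_sum_le_of_le s fun i hi => h i hi α K hK

/-- Bounds multiply by duality: pulled back along `L`, a function bounded by `K` is bounded by `C' *
K`. -/
theorem BoundedBy.map {q r : ℕ} {C C' : ℝ} {z : Chain V q} (h : BoundedBy E C z)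
    (L : Chain V q →ₗ[ℝ] Chain V r) (hL : ∀ x, BoundedBy E C' (L (simplex x))) :
    BoundedBy E (C * C') (L z) := by
  intro α K hK
  have : lift α (L z) = lift (fun x => lift α (L (simplex x))) z := by
    have : lift α ∘ₗ L = lift (fun x => lift α (L (simplex x))) := chain_ext fun x => by simp
    exact LinearMap.congr_fun this z
  rw [this, mul_assoc]
  exact h _ _ fun x => hL x α K hK

theorem BoundedBy.cone {q : ℕ} {C : ℝ} {z : Chain V q} (h : BoundedBy E C z) (m : V) :
    BoundedBy E C (cone q m z) := by
  have := h.map (AlignedCochains.cone q m) (fun x => by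
    rw [cone_simplex]; exact boundedBy_simplex _)
  rwa [mul_one] at this

theorem boundedBy_bd {q : ℕ} (x : Fin (q + 2) → V) :
    ∀ C : ℝ, C = q + 2 → BoundedBy E C (bd q (simplex x)) := by
  rintro C rfl
  rw [bd_simplex]
  have := BoundedBy.sum (E := E) Finset.univ (z := fun i : Fin (q + 2) =>
    ((-1 : ℝ) ^ (i : ℕ)) • simplex (face q i x)) (fun i _ => (boundedBy_simplex _).smul _)
  simpa using this

end Bounds

/-! ### Antisymmetrisation over coherent orderings -/

/-- The signature as a real number. -/
def sgn {n : ℕ} (σ : Equiv.Perm (Fin n)) : ℝ := ((Equiv.Perm.sign σ : ℤ) : ℝ)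

theorem sgn_mul {n : ℕ} (σ τ : Equiv.Perm (Fin n)) : sgn (σ * τ) = sgn σ * sgn τ := by
  simp [sgn]

theorem sgn_mul_self {n : ℕ} (σ : Equiv.Perm (Fin n)) : sgn σ * sgn σ = 1 := by
  unfold sgn
  rw [← Int.cast_mul, ← Units.val_mul, Int.units_mul_self, Units.val_one, Int.cast_one]

theorem abs_sgn {n : ℕ} (σ : Equiv.Perm (Fin n)) : |sgn σ| = 1 := by
  have := sgn_mul_self σ
  rcases mul_self_eq_one_iff.1 this with h | h <;> simp [h]

open Classical in
/-- The coherent orderings of a tuple. -/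
def orderings (T : SimpleGraph V) {q : ℕ} (x : Fin (q + 1) → V) :
    Finset (Equiv.Perm (Fin (q + 1))) := {σ | IsCoherent T (x ∘ σ)}

theorem mem_orderings {q : ℕ} {x : Fin (q + 1) → V} {σ : Equiv.Perm (Fin (q + 1))} :
    σ ∈ orderings T x ↔ IsCoherent T (x ∘ σ) := by
  simp [orderings]

/-- The signed average of the coherent orderings of a tuple. -/
def antisym (T : SimpleGraph V) (q : ℕ) : Chain V q →ₗ[ℝ] Chain V q :=
  lift fun x => ((orderings T x).card : ℝ)⁻¹ • ∑ σ ∈ orderings T x, sgn σ • simplex (x ∘ σ)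

theorem antisym_simplex {q : ℕ} (x : Fin (q + 1) → V) : antisym T q (simplex x) =
    ((orderings T x).card : ℝ)⁻¹ • ∑ σ ∈ orderings T x, sgn σ • simplex (x ∘ σ) :=
  lift_simplex _ _

/-- Left multiplication by `ρ` matches the orderings of `x ∘ ρ` with those of `x`; matched orderings
give the same tuple, with signs differing by `sgn ρ`. -/
theorem antisym_comp {q : ℕ} (x : Fin (q + 1) → V) (ρ : Equiv.Perm (Fin (q + 1))) :
    antisym T q (simplex (x ∘ ρ)) = sgn ρ • antisym T q (simplex x) := by
  have hmap : (orderings T (x ∘ ρ)).map (Equiv.mulLeft ρ).toEmbedding = orderings T x := by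
    ext σ
    simp only [Finset.mem_map_equiv, mem_orderings, Equiv.mulLeft_symm_apply]
    rw [Function.comp_assoc, ← Equiv.Perm.coe_mul, mul_inv_cancel_left]
  rw [antisym_simplex, antisym_simplex, ← hmap, Finset.card_map, Finset.sum_map, smul_comm,
    Finset.smul_sum (r := sgn ρ)]
  congr 1
  refine Finset.sum_congr rfl fun σ _ => ?_
  change _ = sgn ρ • sgn (ρ * σ) • simplex (x ∘ ⇑(ρ * σ))
  rw [smul_smul, sgn_mul, ← mul_assoc, sgn_mul_self, one_mul]
  rfl

theorem antisym_mem {q : ℕ} (z : Chain V q) :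
    antisym T q z ∈ Finsupp.supported ℝ ℝ {x | IsCoherent T x} := by
  refine mem_of_supported (P := Set.univ) _ _ (fun x _ => ?_) (by simp)
  rw [antisym_simplex]
  refine Submodule.smul_mem _ _ (Submodule.sum_mem _ fun σ hσ => Submodule.smul_mem _ _ ?_)
  exact Finsupp.single_mem_supported _ _ (mem_orderings.1 hσ)

theorem antisym_antisym {q : ℕ} (z : Chain V q) : antisym T q (antisym T q z) = antisym T q z := by
  have : antisym T q ∘ₗ antisym T q = antisym T q := by
    refine chain_ext fun x => ?_
    rw [LinearMap.comp_apply]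
    conv_lhs => rw [antisym_simplex x]
    simp only [map_smul, map_sum, antisym_comp, smul_smul, sgn_mul_self, one_smul]
    rw [Finset.sum_const, ← Nat.cast_smul_eq_nsmul ℝ, smul_smul]
    -- A tuple without coherent orderings is sent to zero, consistently with `0⁻¹ = 0`.
    by_cases h : ((orderings T x).card : ℝ) = 0
    · have h' : orderings T x = ∅ := by simpa using h
      simp [antisym_simplex, h']
    · rw [inv_mul_cancel₀ h, one_smul]
  exact LinearMap.congr_fun this z

theorem face_comp {Y : Type*} {q : ℕ} {σ : Equiv.Perm (Fin (q + 2))} {j : Fin (q + 2)}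
    {s : Equiv.Perm (Fin (q + 1))} (hs : ∀ k, σ (j.succAbove k) = (σ j).succAbove (s k))
    (x : Fin (q + 2) → Y) : face q j (x ∘ σ) = face q (σ j) x ∘ s := by
  funext k
  simp [face, hs]

/-- The boundary preserves antisymmetry. -/
theorem antisymmetric_bd {M : Type*} [AddCommGroup M] [Module ℝ M] {q : ℕ}
    {L : Chain V q →ₗ[ℝ] M} (hL : ∀ x (σ : Equiv.Perm (Fin (q + 1))), L (simplex (x ∘ σ)) = sgn σ • L (simplex x))
    (x : Fin (q + 2) → V) (σ : Equiv.Perm (Fin (q + 2))) :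
    L (bd q (simplex (x ∘ σ))) = sgn σ • L (bd q (simplex x)) := by
  choose s hs hsgn using exists_perm_succAbove σ
  rw [bd_simplex, bd_simplex, map_sum, map_sum, Finset.smul_sum,
    ← Equiv.sum_comp σ (fun i => sgn σ • L (_ • simplex (face q i x)))]
  refine Finset.sum_congr rfl fun j _ => ?_
  rw [face_comp (hs j), map_smul, map_smul, hL, smul_smul, smul_smul]
  congr 1
  have := congrArg (fun u : ℤˣ => ((u : ℤ) : ℝ)) (hsgn j)
  unfold sgn
  push_cast at this
  rw [this, mul_comm]

/-- An antisymmetric function vanishing on coherent tuples vanishes on aligned tuples. -/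
theorem antisymmetric_eq_zero (hT : T.IsTree) {M : Type*} [AddCommGroup M] [Module ℝ M] {q : ℕ}
    {L : Chain V q →ₗ[ℝ] M} (hL : ∀ x (σ : Equiv.Perm (Fin (q + 1))), L (simplex (x ∘ σ)) = sgn σ • L (simplex x))
    (h0 : ∀ x, IsCoherent T x → L (simplex x) = 0) {x : Fin (q + 1) → V} (hx : Aligned T x) :
    L (simplex x) = 0 := by
  by_cases hi : Function.Injective x
  · obtain ⟨σ, hσ⟩ := hx.exists_perm hT hi
    have h1 := hL x σ
    rw [h0 (x ∘ σ) hσ] at h1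
    have h2 := congrArg (fun m => sgn σ • m) h1
    rwa [smul_smul, sgn_mul_self, one_smul, smul_zero, eq_comm] at h2
  -- Swapping two equal entries fixes the tuple but reverses the sign.
  · simp only [Function.Injective, not_forall] at hi
    obtain ⟨i, j, hij, hne⟩ := hi
    have h1 := hL x (Equiv.swap i j)
    have h2 : x ∘ Equiv.swap i j = x := by
      funext k
      simp only [Function.comp_apply, Equiv.swap_apply_def]
      split_ifs with h h' <;> simp_all
    rw [h2] at h1
    have h3 : sgn (Equiv.swap i j) = -1 := by simp [sgn, Equiv.Perm.sign_swap hne]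
    rw [h3, neg_smul, one_smul, ← add_eq_zero_iff_eq_neg, ← two_smul ℝ] at h1
    exact (smul_eq_zero.1 h1).resolve_left two_ne_zero

/-- The formula exhibits `antisym` as the transpose of `A_q` on coherent tuples;
`projA_restrict_apply` uses it in this form. -/
theorem antisym_of_isCoherent (hT : T.IsTree) {q : ℕ} {x : Fin (q + 1) → V}
    (hx : IsCoherent T x) : antisym T q (simplex x) =
      (2⁻¹ : ℝ) • (simplex x + revSign q • simplex (x ∘ Fin.revPerm)) := by
  classical
  have h : orderings T x = {1, Fin.revPerm} := by
    ext σ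
    rw [mem_orderings, Finset.mem_insert, Finset.mem_singleton]
    refine ⟨fun h => hx.perm_eq hT h, ?_⟩
    rintro (rfl | rfl)
    · exact hx
    · exact hx.rev
  have hr : revSign q = sgn (Fin.revPerm : Equiv.Perm (Fin (q + 1))) := rfl
  have h1 : sgn (1 : Equiv.Perm (Fin (q + 1))) = 1 := by simp [sgn]
  rw [antisym_simplex, h, hr]
  -- When the reversal is the identity, as in degree zero, there is one ordering instead of two, and
  -- the half-sum still gives the right value.
  by_cases he : (1 : Equiv.Perm (Fin (q + 1))) = Fin.revPerm
  · rw [← he]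
    simp only [Finset.pair_eq_singleton, Finset.sum_singleton, Finset.card_singleton, h1,
      Equiv.Perm.coe_one, Function.comp_id]
    rw [one_smul, ← two_smul ℝ, smul_smul]
    norm_num
  · rw [Finset.sum_pair he, Finset.card_pair he, h1, one_smul]
    simp

theorem antisym_zero (hT : T.IsTree) (z : Chain V 0) : antisym T 0 z = z := by
  have : antisym T 0 = LinearMap.id := by
    refine chain_ext fun x => ?_
    have _ : Subsingleton (Fin (0 + 1)) := inferInstanceAs (Subsingleton (Fin 1))
    have hx : IsCoherent T x := by
      refine ⟨x 0, x 0, .nil, by simp, fun _ => 0, Subsingleton.strictMono _, fun i => ⟨by simp, ?_⟩⟩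
      rw [Subsingleton.elim i 0]
      rfl
    have h : (Fin.revPerm : Equiv.Perm (Fin (0 + 1))) = 1 := Subsingleton.elim _ _
    rw [antisym_of_isCoherent hT hx, revSign, h]
    simp only [Equiv.Perm.sign_one, Units.val_one, Int.cast_one, one_smul, Equiv.Perm.coe_one,
      Function.comp_id, LinearMap.id_apply]
    rw [← two_smul ℝ, smul_smul]
    norm_num
  exact LinearMap.congr_fun this z

/-- Alignment matters: the three ends of a tripod have no coherent ordering, whereas their pairs do.
On aligned tuples, antisymmetry of both sides reduces the identity to coherent tuples; their faces
are coherent, and both sides become half-sums over the tuple and its reversal. -/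
theorem bd_antisym (hT : T.IsTree) {q : ℕ} {z : Chain V (q + 1)}
    (hz : z ∈ Finsupp.supported ℝ ℝ {x | Aligned T x}) :
    bd q (antisym T (q + 1) z) = antisym T q (bd q z) := by
  refine eq_of_supported (L := bd q ∘ₗ antisym T (q + 1)) (L' := antisym T q ∘ₗ bd q)
    (fun x hx => ?_) hz
  rw [← sub_eq_zero, ← LinearMap.sub_apply]
  refine antisymmetric_eq_zero hT (fun x σ => ?_) (fun x hx => ?_) hx
  · simp only [LinearMap.sub_apply, LinearMap.comp_apply, antisym_comp, map_smul,
      antisymmetric_bd (L := antisym T q) antisym_comp, smul_sub]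
  · have hf : ∀ i, IsCoherent T (face q i x) := fun i => hx.comp (Fin.strictMono_succAbove i)
    rw [LinearMap.sub_apply, sub_eq_zero, LinearMap.comp_apply, LinearMap.comp_apply,
      antisym_of_isCoherent hT hx, bd_simplex, map_sum, map_smul, map_add, map_smul, bd_simplex,
      bd_simplex]
    simp only [map_smul, antisym_of_isCoherent hT (hf _), smul_add, Finset.sum_add_distrib,
      Finset.smul_sum]
    congr 1
    · exact Finset.sum_congr rfl fun i _ => smul_comm _ _ _
    · rw [← Equiv.sum_comp Fin.revPerm]
      refine Finset.sum_congr rfl fun i _ => ?_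
      have hf : face q (Fin.revPerm i) (x ∘ Fin.revPerm) = face q i x ∘ Fin.revPerm := by
        funext j
        simp [face, Fin.rev_succAbove]
      rw [hf]
      simp only [smul_smul]
      congr 1
      rw [revSign_succ]
      have hi : (q + 1) = (i : ℕ) + (Fin.revPerm i : Fin (q + 2)) := by
        rw [Fin.revPerm_apply, Fin.val_rev]; omega
      have hs : ((-1 : ℝ) ^ ((Fin.revPerm i : Fin (q + 2)) : ℕ)) *
          (-1) ^ ((Fin.revPerm i : Fin (q + 2)) : ℕ) = 1 := by
        rw [← mul_pow]; simp
      rw [hi, pow_add]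
      linear_combination (2⁻¹ * (-1 : ℝ) ^ (i : ℕ) * revSign q) * hs

theorem chainAct_antisym {q : ℕ} (g : T ≃g T) (z : Chain V q) :
    chainAct q g (antisym T q z) = antisym T q (chainAct q g z) := by
  have : chainAct q g ∘ₗ antisym T q = antisym T q ∘ₗ chainAct q g := by
    refine chain_ext fun x => ?_
    have ho : orderings T (vAct g x) = orderings T x := by
      ext σ
      rw [mem_orderings, mem_orderings]
      refine ⟨fun h => ?_, fun h => h.map g⟩
      have := h.map g.symm
      simpa [vAct, Function.comp_def] using this
    rw [LinearMap.comp_apply, LinearMap.comp_apply, chainAct_simplex, antisym_simplex,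
      antisym_simplex, ho, map_smul, map_sum]
    simp only [map_smul, chainAct_simplex]
    rfl
  exact LinearMap.congr_fun this z

theorem boundedBy_antisym {E : Type*} [NormedAddCommGroup E] [NormedSpace ℝ E] {q : ℕ}
    (x : Fin (q + 1) → V) : BoundedBy E 1 (antisym T q (simplex x)) := by
  rw [antisym_simplex]
  intro α K hK
  have h1 := (BoundedBy.sum (E := E) (orderings T x) (z := fun σ => sgn σ • simplex (x ∘ σ))
    (fun σ _ => (boundedBy_simplex _).smul _)).smul ((orderings T x).card : ℝ)⁻¹ α K hK
  have hK0 : 0 ≤ K := (norm_nonneg _).trans (hK x)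
  refine h1.trans (mul_le_mul_of_nonneg_right ?_ hK0)
  simp only [abs_sgn, mul_one, Finset.sum_const, nsmul_eq_mul, abs_inv, Nat.abs_cast]
  exact inv_mul_le_one

end Chains

/-! ### The contraction towards a base vertex and the projection to coherent chains -/

section Contraction

variable {V : Type*} {T : SimpleGraph V} (hT : T.IsTree)

/-- The contraction of aligned chains towards `o`. -/
def contraction (o : V) : ∀ q, Chain V q →ₗ[ℝ] Chain V (q + 1)
  | 0 => cone 0 o
  | q + 1 => lift fun x =>
      cone (q + 1) (meet hT o x) (simplex x - contraction o q (bd q (simplex x)))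

theorem contraction_succ (o : V) (q : ℕ) (x : Fin (q + 2) → V) :
    contraction hT o (q + 1) (simplex x) =
      cone (q + 1) (meet hT o x) (simplex x - contraction hT o q (bd q (simplex x))) :=
  lift_simplex _ _

/-- The aligned tuples in the hull of `o` and the `x i`. -/
def hullTuples (T : SimpleGraph V) (o : V) {n : ℕ} (x : Fin n → V) (r : ℕ) :
    Set (Fin r → V) := {y | Aligned T y ∧ ∀ j, ∃ i, Btw T o (y j) (x i)}

theorem simplex_mem_hullTuples {o : V} {q : ℕ} {x : Fin (q + 1) → V} (hx : Aligned T x) :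
    simplex x ∈ Finsupp.supported ℝ ℝ (hullTuples T o x (q + 1)) :=
  Finsupp.single_mem_supported _ _ ⟨hx, fun j => ⟨j, by simp [Btw]⟩⟩

theorem bd_mem_supported {q : ℕ} {P : Set (Fin (q + 1) → V)} {x : Fin (q + 2) → V}
    (h : ∀ i, face q i x ∈ P) : bd q (simplex x) ∈ Finsupp.supported ℝ ℝ P := by
  rw [bd_simplex]
  exact Submodule.sum_mem _ fun i _ =>
    Submodule.smul_mem _ _ (Finsupp.single_mem_supported _ _ (h i))

theorem Aligned.face {q : ℕ} {x : Fin (q + 2) → V} (hx : Aligned T x) (i : Fin (q + 2)) :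
    Aligned T (face q i x) := hx.comp _

/-- Alignment alone would not survive the induction: `collinear_meet` applies only to points of the
hull of `o` and `x`, so the support is tracked as well. The hull of a face is contained in that of
`x`. -/
theorem contraction_mem_hullTuples (o : V) (q : ℕ) {x : Fin (q + 1) → V} (hx : Aligned T x) :
    contraction hT o q (simplex x) ∈ Finsupp.supported ℝ ℝ (hullTuples T o x (q + 2)) := by
  induction q with
  | zero =>
    have _ : Subsingleton (Fin (0 + 1)) := inferInstanceAs (Subsingleton (Fin 1))
    rw [contraction, cone_simplex]
    refine Finsupp.single_mem_supported _ _ ⟨aligned_cons hx o fun i j => ?_, fun j => ⟨0, ?_⟩⟩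
    · rw [Subsingleton.elim i j]
      exact (collinear_self _ _).rotate.rotate
    · cases j using Fin.cases with
      | zero => simp [Btw]
      | succ j => rw [Subsingleton.elim j 0]; simp [Btw]
  | succ q ih =>
    rw [contraction_succ]
    have h1 : simplex x - contraction hT o q (bd q (simplex x)) ∈
        Finsupp.supported ℝ ℝ (hullTuples T o x (q + 2)) := by
      refine Submodule.sub_mem _ (simplex_mem_hullTuples hx) ?_
      refine mem_of_supported (P := {y | ∃ i, y = face q i x}) _ _ ?_
        (bd_mem_supported fun i => ⟨i, rfl⟩)
      rintro _ ⟨i, rfl⟩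
      refine Finsupp.supported_mono ?_ (ih (hx.face i))
      rintro y ⟨hy, hy'⟩
      refine ⟨hy, fun j => ?_⟩
      obtain ⟨k, hk⟩ := hy' j
      exact ⟨_, hk⟩
    refine mem_of_supported _ _ ?_ h1
    rintro y ⟨hy, hy'⟩
    rw [cone_simplex]
    refine Finsupp.single_mem_supported _ _ ⟨aligned_cons hy _ fun i j => ?_, fun j => ?_⟩
    · obtain ⟨k, hk⟩ := hy' i
      obtain ⟨l, hl⟩ := hy' j
      exact collinear_meet hT hx hk hl
    · cases j using Fin.cases with
      | zero => exact ⟨0, meet_btw hT o x 0⟩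
      | succ j => exact hy' j

theorem contraction_mem_aligned (o : V) (q : ℕ) {z : Chain V q}
    (hz : z ∈ Finsupp.supported ℝ ℝ {x | Aligned T x}) :
    contraction hT o q z ∈ Finsupp.supported ℝ ℝ {x | Aligned T x} :=
  mem_of_supported _ _ (fun _ hx =>
    Finsupp.supported_mono (fun _ hy => hy.1) (contraction_mem_hullTuples hT o q hx)) hz

theorem bd_contraction_zero (o : V) (z : Chain V 0) :
    bd 0 (contraction hT o 0 z) = z - aug z • simplex (fun _ => o) := bd_cone_zero o z

/-- Inductively, a tuple minus the contraction of its boundary is a cycle, and coning a cycle fills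
it whatever the apex. -/
theorem bd_contraction (o : V) (q : ℕ) {z : Chain V (q + 1)}
    (hz : z ∈ Finsupp.supported ℝ ℝ {x | Aligned T x}) :
    bd (q + 1) (contraction hT o (q + 1) z) = z - contraction hT o q (bd q z) := by
  induction q with
  | zero =>
    refine eq_of_supported (L := bd 1 ∘ₗ contraction hT o 1)
      (L' := LinearMap.id - contraction hT o 0 ∘ₗ bd 0) (fun x hx => ?_) hz
    simp only [LinearMap.comp_apply, LinearMap.sub_apply, LinearMap.id_apply]
    rw [contraction_succ, bd_cone, map_sub, bd_contraction_zero, aug_bd]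
    simp
  | succ q ih =>
    refine eq_of_supported (L := bd (q + 2) ∘ₗ contraction hT o (q + 2))
      (L' := LinearMap.id - contraction hT o (q + 1) ∘ₗ bd (q + 1)) (fun x hx => ?_) hz
    simp only [LinearMap.comp_apply, LinearMap.sub_apply, LinearMap.id_apply]
    rw [contraction_succ, bd_cone, map_sub, ih (bd_mem_supported fun i => Aligned.face hx i), bd_bd]
    simp

/-- The root moves with `g`, so equivariance requires a root chosen naturally from the tuple;
`coherentProj` takes the first entry. -/
theorem chainAct_contraction (g : T ≃g T) (o : V) (q : ℕ) (z : Chain V q) :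
    chainAct (q + 1) g (contraction hT o q z) = contraction hT (g o) q (chainAct q g z) := by
  induction q with
  | zero => exact chainAct_cone g o z
  | succ q ih =>
    have : chainAct (q + 2) g ∘ₗ contraction hT o (q + 1) =
        contraction hT (g o) (q + 1) ∘ₗ chainAct (q + 1) g := by
      refine chain_ext fun x => ?_
      rw [LinearMap.comp_apply, LinearMap.comp_apply, chainAct_simplex, contraction_succ,
        contraction_succ, chainAct_cone, map_sub, ih, chainAct_bd, chainAct_simplex]
      congr 2
      exact (meet_map hT g o x).symm
    exact LinearMap.congr_fun this z

theorem exists_boundedBy_contraction (E : Type*) [NormedAddCommGroup E] [NormedSpace ℝ E] (q : ℕ) :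
    ∃ C, ∀ (o : V) (x : Fin (q + 1) → V), BoundedBy E C (contraction hT o q (simplex x)) := by
  induction q with
  | zero => exact ⟨1, fun o x => (boundedBy_simplex x).cone o⟩
  | succ q ih =>
    obtain ⟨C, hC⟩ := ih
    -- The summand `1` comes from the tuple itself, the other from the contractions of its `q + 2`
    -- faces.
    refine ⟨1 + (q + 2) * C, fun o x => ?_⟩
    rw [contraction_succ]
    exact ((boundedBy_simplex x).sub ((boundedBy_bd x _ rfl).map _ (hC o))).cone _

open Classical in
/-- The equivariant chain map from all chains to coherent chains. -/
def coherentProj : ∀ q, Chain V q →ₗ[ℝ] Chain V q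
  | 0 => antisym T 0
  | q + 1 => lift fun x => antisym T (q + 1) (if IsCoherent T x then simplex x else
      contraction hT (x 0) q (coherentProj q (bd q (simplex x))))

theorem coherentProj_of_isCoherent {q : ℕ} {x : Fin (q + 1) → V} (hx : IsCoherent T x) :
    coherentProj hT q (simplex x) = antisym T q (simplex x) := by
  cases q with
  | zero => rfl
  | succ q => rw [coherentProj, lift_simplex, if_pos hx]

theorem coherentProj_of_not_isCoherent {q : ℕ} {x : Fin (q + 2) → V} (hx : ¬ IsCoherent T x) :
    coherentProj hT (q + 1) (simplex x) = antisym T (q + 1)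
      (contraction hT (x 0) q (coherentProj hT q (bd q (simplex x)))) := by
  rw [coherentProj, lift_simplex, if_neg hx]

theorem coherentProj_zero (z : Chain V 0) : coherentProj hT 0 z = z := antisym_zero hT z

theorem antisym_coherentProj (q : ℕ) (z : Chain V q) :
    antisym T q (coherentProj hT q z) = coherentProj hT q z := by
  cases q with
  | zero => exact antisym_antisym z
  | succ q =>
    have : antisym T (q + 1) ∘ₗ coherentProj hT (q + 1) = coherentProj hT (q + 1) := by
      refine chain_ext fun x => ?_
      rw [LinearMap.comp_apply, coherentProj, lift_simplex, antisym_antisym]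
    exact LinearMap.congr_fun this z

theorem coherentProj_mem (q : ℕ) (z : Chain V q) :
    coherentProj hT q z ∈ Finsupp.supported ℝ ℝ {x | IsCoherent T x} := by
  rw [← antisym_coherentProj]
  exact antisym_mem _

theorem coherent_le_aligned {T : SimpleGraph V} (hT : T.IsTree) (q : ℕ) :
    Finsupp.supported ℝ ℝ {x : Fin (q + 1) → V | IsCoherent T x} ≤ Finsupp.supported ℝ ℝ {x | Aligned T x} :=
  Finsupp.supported_mono fun _ hx => hx.aligned hT

/-- On coherent chains, the antisymmetrised contraction is a homotopy from `antisym` to zero. -/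
theorem bd_antisym_contraction (o : V) (q : ℕ) {z : Chain V (q + 1)}
    (hz : z ∈ Finsupp.supported ℝ ℝ {x | IsCoherent T x}) :
    bd (q + 1) (antisym T (q + 2) (contraction hT o (q + 1) z)) =
      antisym T (q + 1) z - antisym T (q + 1) (contraction hT o q (bd q z)) := by
  have hz' := coherent_le_aligned hT _ hz
  rw [bd_antisym hT (contraction_mem_aligned hT o _ hz'), bd_contraction hT o q hz', map_sub]

theorem bd_antisym_contraction_zero (o : V) {z : Chain V 0}
    (hz : z ∈ Finsupp.supported ℝ ℝ {x | IsCoherent T x}) :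
    bd 0 (antisym T 1 (contraction hT o 0 z)) = z - aug z • simplex (fun _ => o) := by
  have hz' := coherent_le_aligned hT _ hz
  rw [bd_antisym hT (contraction_mem_aligned hT o _ hz'), bd_contraction_zero hT o,
    antisym_zero hT]

/-- For a tuple that is not coherent, the image of its boundary is a coherent cycle by induction,
which the antisymmetrised contraction fills. In the lowest degree the obstruction is the
augmentation, which vanishes on boundaries. -/
theorem bd_coherentProj (q : ℕ) (z : Chain V (q + 1)) :
    bd q (coherentProj hT (q + 1) z) = coherentProj hT q (bd q z) := by
  induction q with
  | zero =>
    have : bd 0 ∘ₗ coherentProj hT 1 = coherentProj hT 0 ∘ₗ bd 0 := by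
      refine chain_ext fun x => ?_
      rw [LinearMap.comp_apply, LinearMap.comp_apply]
      by_cases hx : IsCoherent T x
      · rw [coherentProj_of_isCoherent hT hx, bd_antisym hT, coherentProj]
        exact Finsupp.single_mem_supported _ _ (hx.aligned hT)
      · rw [coherentProj_of_not_isCoherent hT hx, bd_antisym_contraction_zero hT,
          coherentProj_zero, aug_bd, zero_smul, sub_zero]
        exact coherentProj_mem hT _ _
    exact LinearMap.congr_fun this z
  | succ q ih =>
    have : bd (q + 1) ∘ₗ coherentProj hT (q + 2) = coherentProj hT (q + 1) ∘ₗ bd (q + 1) := by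
      refine chain_ext fun x => ?_
      rw [LinearMap.comp_apply, LinearMap.comp_apply]
      by_cases hx : IsCoherent T x
      · rw [coherentProj_of_isCoherent hT hx, bd_antisym hT]
        · refine eq_of_supported (P := {x | IsCoherent T x})
            (fun y hy => (coherentProj_of_isCoherent hT hy).symm) ?_
          exact bd_mem_supported fun i => hx.comp (Fin.strictMono_succAbove i)
        · exact Finsupp.single_mem_supported _ _ (hx.aligned hT)
      · rw [coherentProj_of_not_isCoherent hT hx, bd_antisym_contraction hT _ _
          (coherentProj_mem hT _ _), ih, bd_bd, antisym_coherentProj]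
        simp
    exact LinearMap.congr_fun this z

theorem chainAct_coherentProj (g : T ≃g T) (q : ℕ) (z : Chain V q) :
    chainAct q g (coherentProj hT q z) = coherentProj hT q (chainAct q g z) := by
  induction q with
  | zero => exact chainAct_antisym g z
  | succ q ih =>
    have : chainAct (q + 1) g ∘ₗ coherentProj hT (q + 1) =
        coherentProj hT (q + 1) ∘ₗ chainAct (q + 1) g := by
      refine chain_ext fun x => ?_
      rw [LinearMap.comp_apply, LinearMap.comp_apply, chainAct_simplex]
      by_cases hx : IsCoherent T x
      · have hx' : IsCoherent T (vAct g x) := hx.map g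
        rw [coherentProj_of_isCoherent hT hx, coherentProj_of_isCoherent hT hx', chainAct_antisym,
          chainAct_simplex]
      · have hx' : ¬ IsCoherent T (vAct g x) := fun h => hx (by
          simpa [vAct] using h.map g.symm)
        rw [coherentProj_of_not_isCoherent hT hx, coherentProj_of_not_isCoherent hT hx',
          chainAct_antisym, chainAct_contraction, ih, chainAct_bd, chainAct_simplex]
        rfl
    exact LinearMap.congr_fun this z

theorem exists_boundedBy_coherentProj (E : Type*) [NormedAddCommGroup E] [NormedSpace ℝ E] (q : ℕ) :
    ∃ C, 0 ≤ C ∧ ∀ x : Fin (q + 1) → V, BoundedBy E C (coherentProj hT q (simplex x)) := by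
  induction q with
  | zero => exact ⟨1, zero_le_one, fun x => boundedBy_antisym x⟩
  | succ q ih =>
    obtain ⟨C, -, hC⟩ := ih
    obtain ⟨C', hC'⟩ := exists_boundedBy_contraction hT E q
    refine ⟨max 1 ((q + 2) * C * C'), le_max_of_le_left zero_le_one, fun x => ?_⟩
    intro α K hK
    have hK0 : 0 ≤ K := (norm_nonneg _).trans (hK x)
    by_cases hx : IsCoherent T x
    · rw [coherentProj_of_isCoherent hT hx]
      exact (boundedBy_antisym x α K hK).trans
        (mul_le_mul_of_nonneg_right (le_max_left _ _) hK0)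
    · rw [coherentProj_of_not_isCoherent hT hx]
      have h := (((boundedBy_bd x _ rfl).map (coherentProj hT q) hC).map _ (hC' (x 0))).map
        (antisym T (q + 1)) (fun y => boundedBy_antisym (E := E) y)
      rw [mul_one] at h
      exact (h α K hK).trans (mul_le_mul_of_nonneg_right (le_max_right _ _) hK0)

end Contraction

/-! ### The homogeneous differential on functions -/

section BoundedFunctions

variable {X E : Type*} [NormedAddCommGroup E]

/-- A bounded function as an element of `ℓ^∞`. -/
def mkLInf (f : X → E) (C : ℝ) (h : ∀ x, ‖f x‖ ≤ C) : LInf X E :=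
  ⟨f, memℓp_infty ⟨C, by rintro _ ⟨x, rfl⟩; exact h x⟩⟩

theorem norm_apply_le (α : LInf X E) (x : X) : ‖α x‖ ≤ ‖α‖ :=
  lp.norm_apply_le_norm ENNReal.top_ne_zero α x

end BoundedFunctions

section Codiff

variable {Y E : Type*} [NormedAddCommGroup E] [NormedSpace ℝ E]

/-- The homogeneous differential of a function on tuples. -/
def codiff {q : ℕ} (F : (Fin (q + 1) → Y) → E) : (Fin (q + 2) → Y) → E :=
  fun x => ∑ i : Fin (q + 2), ((-1 : ℝ) ^ (i : ℕ)) • F (face q i x)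

theorem lift_bd {q : ℕ} (F : (Fin (q + 1) → Y) → E) (z : Chain Y (q + 1)) :
    lift F (bd q z) = lift (codiff F) z := by
  have : lift F ∘ₗ bd q = lift (codiff F) :=
    chain_ext fun x => by
      simp only [LinearMap.comp_apply, bd_simplex, map_sum, map_smul, lift_simplex, codiff]
  exact LinearMap.congr_fun this z

theorem codiff_eq_lift {q : ℕ} (F : (Fin (q + 1) → Y) → E) (x : Fin (q + 2) → Y) :
    codiff F x = lift F (bd q (simplex x)) := by
  rw [lift_bd, lift_simplex]

theorem codiff_codiff {q : ℕ} (F : (Fin (q + 1) → Y) → E) : codiff (codiff F) = 0 := by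
  funext x
  rw [codiff_eq_lift, ← lift_bd, bd_bd, map_zero]
  rfl

theorem codiff_sub {q : ℕ} (F F' : (Fin (q + 1) → Y) → E) :
    codiff (F - F') = codiff F - codiff F' := by
  funext x
  simp [codiff, smul_sub]

theorem lift_add_fun {q : ℕ} (F F' : (Fin (q + 1) → Y) → E) (z : Chain Y q) :
    lift (F + F') z = lift F z + lift F' z :=
  LinearMap.congr_fun (chain_ext (L := lift (F + F')) (L' := lift F + lift F') (by simp)) z

theorem lift_sub_fun {q : ℕ} (F F' : (Fin (q + 1) → Y) → E) (z : Chain Y q) :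
    lift (F - F') z = lift F z - lift F' z :=
  LinearMap.congr_fun (chain_ext (L := lift (F - F')) (L' := lift F - lift F') (by simp)) z

theorem lift_smul_fun {q : ℕ} (c : ℝ) (F : (Fin (q + 1) → Y) → E) (z : Chain Y q) :
    lift (c • F) z = c • lift F z :=
  LinearMap.congr_fun (chain_ext (L := lift (c • F)) (L' := c • lift F) (by simp)) z

theorem norm_codiff_le {q : ℕ} {F : (Fin (q + 1) → Y) → E} {K : ℝ} (h : ∀ x, ‖F x‖ ≤ K)
    (x : Fin (q + 2) → Y) : ‖codiff F x‖ ≤ (q + 2) * K := by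
  rw [codiff_eq_lift]
  exact boundedBy_bd x _ rfl F K h

end Codiff

/-! ### Coherent cochains -/

section ExtendZero

variable {V : Type*} {T : SimpleGraph V} {E : Type*} [NormedAddCommGroup E]

open Classical in
/-- The extension by zero of a function on coherent tuples. -/
def extendZero {q : ℕ} (α : LInf (Coh T (q + 1)) E) : (Fin (q + 1) → V) → E :=
  fun x => if h : IsCoherent T x then α ⟨x, h⟩ else 0

theorem extendZero_of_isCoherent {q : ℕ} (α : LInf (Coh T (q + 1)) E) {x : Fin (q + 1) → V}
    (h : IsCoherent T x) : extendZero α x = α ⟨x, h⟩ := dif_pos h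

theorem norm_extendZero_le {q : ℕ} (α : LInf (Coh T (q + 1)) E) (x : Fin (q + 1) → V) :
    ‖extendZero α x‖ ≤ ‖α‖ := by
  unfold extendZero
  split_ifs with h
  · exact norm_apply_le α _
  · simp

theorem extendZero_add {q : ℕ} (α β : LInf (Coh T (q + 1)) E) :
    extendZero (α + β) = extendZero α + extendZero β := by
  funext x
  by_cases h : IsCoherent T x <;> simp [extendZero, h]

end ExtendZero

section CoherentCochains

variable {V : Type*} {T : SimpleGraph V} {E : Type*} [NormedAddCommGroup E] [NormedSpace ℝ E]

theorem extendZero_smul {q : ℕ} (c : ℝ) (α : LInf (Coh T (q + 1)) E) :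
    extendZero (c • α) = c • extendZero α := by
  funext x
  by_cases h : IsCoherent T x <;> simp [extendZero, h]

theorem isCoherent_vAct (g : T ≃g T) {n : ℕ} {x : Fin n → V} :
    IsCoherent T (vAct g x) ↔ IsCoherent T x :=
  ⟨fun h => by simpa [vAct] using h.map g.symm, fun h => h.map g⟩

theorem extendZero_vAct {ρ : (T ≃g T) →* (E ≃ₗᵢ[ℝ] E)} {q : ℕ} {α : LInf (Coh T (q + 1)) E}
    (hα : α ∈ equivariant ρ Coh.act) (g : T ≃g T) (x : Fin (q + 1) → V) :
    extendZero α (vAct g x) = ρ g (extendZero α x) := by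
  by_cases h : IsCoherent T x
  · rw [extendZero_of_isCoherent α h, extendZero_of_isCoherent α ((isCoherent_vAct g).2 h)]
    exact hα g ⟨x, h⟩
  · have h' : ¬ IsCoherent T (vAct g x) := fun h' => h ((isCoherent_vAct g).1 h')
    simp [extendZero, h, h']

theorem cohDiff_apply_eq_lift {q : ℕ} (α : LInf (Coh T (q + 1)) E) (x : Coh T (q + 2)) :
    cohDiff T E q α x = lift (extendZero α) (bd q (simplex x.1)) := by
  rw [diff_apply, ← codiff_eq_lift]
  refine Finset.sum_congr rfl fun i _ => ?_
  exact congrArg _ (extendZero_of_isCoherent α (Coh.face q i x).2).symm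

theorem lift_extendZero_cohDiff {q : ℕ} (α : LInf (Coh T (q + 1)) E) {z : Chain V (q + 1)}
    (hz : z ∈ Finsupp.supported ℝ ℝ {x | IsCoherent T x}) :
    lift (extendZero (cohDiff T E q α)) z = lift (extendZero α) (bd q z) := by
  refine eq_of_supported (L' := lift (extendZero α) ∘ₗ bd q) (fun x hx => ?_) hz
  rw [lift_simplex, extendZero_of_isCoherent _ hx, cohDiff_apply_eq_lift, LinearMap.comp_apply]

theorem cohDiff_cohDiff (q : ℕ) (α : LInf (Coh T (q + 1)) E) :
    cohDiff T E (q + 1) (cohDiff T E q α) = 0 := by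
  ext x
  rw [cohDiff_apply_eq_lift, lift_extendZero_cohDiff, bd_bd, map_zero]
  · rfl
  · exact bd_mem_supported fun i => x.2.comp (Fin.strictMono_succAbove i)

theorem projA_restrict_apply (hT : T.IsTree) {q : ℕ} (β : LInf (Coh T (q + 1)) E)
    (x : Coh T (q + 1)) :
    projA T E q β x = lift (extendZero β) (antisym T q (simplex x.1)) := by
  rw [antisym_of_isCoherent hT x.2, map_smul, map_add, map_smul, lift_simplex, lift_simplex,
    extendZero_of_isCoherent β x.2, add_comm (β _)]
  exact congrArg (fun e => (2⁻¹ : ℝ) • (revSign q • e + β x))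
    (extendZero_of_isCoherent β x.rev.2).symm

theorem projA_of_mem_plus {q : ℕ} {α : LInf (Coh T (q + 1)) E} (hα : α ∈ plus T E q) :
    projA T E q α = α := by
  have h : tauHat T E q α = α := hα
  change (2⁻¹ : ℝ) • (tauHat T E q α + α) = α
  rw [h, ← two_smul ℝ, smul_smul]
  norm_num

theorem lift_antisym_of_mem_plus (hT : T.IsTree) {q : ℕ} {α : LInf (Coh T (q + 1)) E} (hα : α ∈ plus T E q)
    {z : Chain V q} (hz : z ∈ Finsupp.supported ℝ ℝ {x | IsCoherent T x}) :
    lift (extendZero α) (antisym T q z) = lift (extendZero α) z := by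
  refine eq_of_supported (L := lift (extendZero α) ∘ₗ antisym T q) (fun x hx => ?_) hz
  rw [LinearMap.comp_apply, ← projA_restrict_apply hT α ⟨x, hx⟩, projA_of_mem_plus hα,
    lift_simplex, extendZero_of_isCoherent α hx]

theorem lift_extendZero_projA_rest (hT : T.IsTree) {q : ℕ} (β : LInf (Fin (q + 1) → V) E) {z : Chain V q}
    (hz : z ∈ Finsupp.supported ℝ ℝ {x | IsCoherent T x}) :
    lift (extendZero (projA T E q (rest T q β))) z = lift (fun x => β x) (antisym T q z) := by
  refine eq_of_supported (L' := lift (fun x => β x) ∘ₗ antisym T q) (fun x hx => ?_) hz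
  rw [lift_simplex, LinearMap.comp_apply, extendZero_of_isCoherent _ hx, projA_restrict_apply hT]
  refine eq_of_supported (fun y hy => ?_) (antisym_mem _)
  rw [lift_simplex, lift_simplex, extendZero_of_isCoherent _ hy]
  rfl

/-- The primitive of a cocycle provided by the contraction towards `o`. -/
theorem exists_primitive (hT : T.IsTree) (o : V) (q : ℕ) {α : LInf (Coh T (q + 2)) E}
    (hα : α ∈ plus T E (q + 1))
    (hd : cohDiff T E (q + 1) α = 0) : ∃ β ∈ plus T E q, cohDiff T E q β = α := by
  obtain ⟨C, hC⟩ := exists_boundedBy_contraction hT E q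
  have hb : ∀ x : Coh T (q + 1), ‖lift (extendZero α)
      (antisym T (q + 1) (contraction hT o q (simplex x.1)))‖ ≤ C * ‖α‖ := by
    intro x
    have := ((hC o x.1).map (antisym T (q + 1)) (fun y => boundedBy_antisym (E := E) y))
    rw [mul_one] at this
    exact this _ _ (norm_extendZero_le α)
  have h0 : ∀ z ∈ Finsupp.supported ℝ ℝ {x : Fin (q + 3) → V | IsCoherent T x},
      lift (extendZero α) (bd (q + 1) z) = 0 := by
    intro z hz
    rw [← lift_extendZero_cohDiff α hz, hd]
    have : extendZero (0 : LInf (Coh T (q + 3)) E) = 0 := by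
      funext x
      by_cases h : IsCoherent T x <;> simp [extendZero, h]
    rw [this]
    exact LinearMap.congr_fun (chain_ext (L := lift (0 : (Fin (q + 3) → V) → E)) (L' := 0)
      (by simp)) z
  -- This cochain need not lie in the `+1` eigenspace. Applying `A_q` puts it there, and since `A`
  -- commutes with the differential and fixes `α`, the coboundary is still `α`.
  let β : LInf (Coh T (q + 1)) E := mkLInf _ _ hb
  refine ⟨projA T E q β, projA_mem T q β, ?_⟩
  rw [← projA_diff]
  refine (congrArg _ ?_).trans (projA_of_mem_plus hα)
  ext x
  have hbd : bd q (simplex x.1) ∈ Finsupp.supported ℝ ℝ {x | IsCoherent T x} :=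
    bd_mem_supported fun i => x.2.comp (Fin.strictMono_succAbove i)
  have hx : simplex x.1 ∈ Finsupp.supported ℝ ℝ {x | IsCoherent T x} :=
    Finsupp.single_mem_supported _ _ x.2
  have h1 : cohDiff T E q β x =
      lift (extendZero α) (antisym T (q + 1) (contraction hT o q (bd q (simplex x.1)))) := by
    rw [cohDiff_apply_eq_lift]
    refine eq_of_supported (L' := lift (extendZero α) ∘ₗ antisym T (q + 1) ∘ₗ contraction hT o q)
      (fun y hy => ?_) hbd
    rw [lift_simplex, extendZero_of_isCoherent _ hy]
    rfl
  -- The cocycle `α` vanishes on this boundary; expanding it by the homotopy formula expresses `α x`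
  -- as the coboundary of `β`.
  have h2 := h0 _ (antisym_mem (contraction hT o (q + 1) (simplex x.1)))
  rw [bd_antisym_contraction hT o q hx, map_sub, sub_eq_zero, lift_antisym_of_mem_plus hT hα hx,
    lift_simplex, extendZero_of_isCoherent _ x.2] at h2
  rw [h1, ← h2]

/-- In degree zero `antisym` is the identity, yet its values are supported on coherent tuples. -/
theorem isCoherent_one (hT : T.IsTree) (x : Fin 1 → V) : IsCoherent T x := by
  have h := (antisym_mem (T := T) (simplex x))
  rw [antisym_zero hT] at h
  have : x ∈ ((simplex x).support : Set (Fin 1 → V)) := by simp [simplex]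
  exact h this

/-- A cocycle in degree zero is constant. -/
theorem eq_of_cohDiff_eq_zero (hT : T.IsTree) {α : LInf (Coh T 1) E} (hd : cohDiff T E 0 α = 0)
    (x y : Coh T 1) : α x = α y := by
  have hx : simplex x.1 ∈ Finsupp.supported ℝ ℝ {x | IsCoherent T x} :=
    Finsupp.single_mem_supported _ _ x.2
  have h1 := lift_extendZero_cohDiff α (antisym_mem (contraction hT (y.1 0) 0 (simplex x.1)))
  have hz : extendZero (0 : LInf (Coh T 2) E) = 0 := by
    funext x
    by_cases h : IsCoherent T x <;> simp [extendZero, h]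
  have hl : ∀ z, lift (0 : (Fin 2 → V) → E) z = 0 := fun z =>
    LinearMap.congr_fun (chain_ext (L := lift (0 : (Fin 2 → V) → E)) (L' := 0) (by simp)) z
  have hy : (fun _ => y.1 0) = y.1 := funext fun i => by rw [Fin.fin_one_eq_zero i]
  rw [hd, hz, hl, bd_antisym_contraction_zero hT _ hx, map_sub, map_smul, aug_simplex, one_smul,
    lift_simplex, lift_simplex, hy, extendZero_of_isCoherent α x.2, extendZero_of_isCoherent α y.2,
    eq_comm, sub_eq_zero] at h1
  exact h1

end CoherentCochains

/-! ### Natural cochain maps are homotopic to the identity -/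

section Homotopy

universe u v w

variable {Y : Type u} [TopologicalSpace Y] {E : Type v} [NormedAddCommGroup E] [NormedSpace ℝ E]
  {G : Type w} [Group G]

/-- A family of operators from functions on tuples in `X` to functions on tuples in `Y`, such that
continuous functions are treated linearly, compatibly with the differential and the actions. -/
structure IsCochainMap {X : Type u} [TopologicalSpace X] (ρ : G →* (E ≃ₗᵢ[ℝ] E))
    (actX : G → X → X) (actY : G → Y → Y)
    (Θ : ∀ q, ((Fin (q + 1) → X) → E) → ((Fin (q + 1) → Y) → E)) : Prop where
  sub : ∀ q F F', Continuous F → Continuous F' → Θ q (F - F') = Θ q F - Θ q F'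
  codiff : ∀ q F, Continuous F → Θ (q + 1) (codiff F) = codiff (Θ q F)
  const : ∀ e, Θ 0 (fun _ => e) = fun _ => e
  bound : ∀ q, ∃ C, ∀ F K, Continuous F → (∀ x, ‖F x‖ ≤ K) → ∀ y, ‖Θ q F y‖ ≤ C * K
  -- The condition concerns pairs of functions on all tuples because freezing a variable destroys
  -- the invariance of a single function.
  equivariant : ∀ q g F F', (∀ x, F' (fun i => actX g (x i)) = ρ g (F x)) →
    ∀ y, Θ q F' (fun i => actY g (y i)) = ρ g (Θ q F y)
  -- Parameters are required because the homotopy freezes the first entry and then lets it vary. The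
  -- products `Z × Y` occurring in the recursion stay in the same universe.
  continuous : ∀ q (Z : Type u) [TopologicalSpace Z] (F : Z → (Fin (q + 1) → X) → E),
    Continuous (fun p : Z × (Fin (q + 1) → X) => F p.1 p.2) →
    Continuous fun p : Z × (Fin (q + 1) → Y) => Θ q (F p.1) p.2

/-- Evaluation with prescribed initial entry. -/
def shift {X E : Type*} {q : ℕ} (a : X) (F : (Fin (q + 2) → X) → E) : (Fin (q + 1) → X) → E :=
  fun x => F (Fin.cons a x)

theorem shift_codiff {X : Type*} {q : ℕ} (a : X) (F : (Fin (q + 2) → X) → E) :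
    shift a (codiff F) = F - codiff (shift a F) := by
  funext x
  simp only [shift, codiff, Fin.sum_univ_succ (n := q + 2), face_zero_cons, face_succ_cons,
    Pi.sub_apply]
  simp [pow_succ, sub_eq_add_neg, Finset.sum_neg_distrib]

theorem shift_codiff_zero {X : Type*} (a : X) (F : (Fin 1 → X) → E) :
    shift a (codiff F) = F - fun _ => F fun _ => a := by
  funext x
  simp only [shift, codiff, Fin.sum_univ_succ (n := 1), face_zero_cons, face_one_cons,
    Pi.sub_apply]
  simp [sub_eq_add_neg]

theorem continuous_shift {X : Type*} [TopologicalSpace X] {E : Type*} [TopologicalSpace E]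
    {q : ℕ} {Z : Type*} [TopologicalSpace Z] {F : Z → (Fin (q + 2) → X) → E}
    (hF : Continuous fun p : Z × (Fin (q + 2) → X) => F p.1 p.2) :
    Continuous fun p : (Z × X) × (Fin (q + 1) → X) => shift p.1.2 (F p.1.1) p.2 := by
  refine hF.comp ((continuous_fst.comp continuous_fst).prodMk (continuous_pi fun i => ?_))
  cases i using Fin.cases with
  | zero => exact continuous_snd.comp continuous_fst
  | succ i => exact (continuous_apply i).comp continuous_snd

theorem continuous_shift_apply {X : Type*} [TopologicalSpace X] {E : Type*} [TopologicalSpace E]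
    {q : ℕ} {F : (Fin (q + 2) → X) → E} (hF : Continuous F) (a : X) : Continuous (shift a F) := by
  refine hF.comp (continuous_pi fun i => ?_)
  cases i using Fin.cases with
  | zero => exact continuous_const
  | succ i => exact continuous_apply i

theorem continuous_face {X : Type*} [TopologicalSpace X] (q : ℕ) (i : Fin (q + 2)) :
    Continuous (face q i : (Fin (q + 2) → X) → Fin (q + 1) → X) :=
  continuous_pi fun _ => continuous_apply _

theorem continuous_codiff {X : Type*} [TopologicalSpace X] {q : ℕ} {Z : Type*}
    [TopologicalSpace Z] {F : Z → (Fin (q + 1) → X) → E}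
    (hF : Continuous fun p : Z × (Fin (q + 1) → X) => F p.1 p.2) :
    Continuous fun p : Z × (Fin (q + 2) → X) => codiff (F p.1) p.2 := by
  refine continuous_finsetSum _ fun i _ => Continuous.const_smul ?_ _
  exact hF.comp (continuous_fst.prodMk ((continuous_face q i).comp continuous_snd))

theorem Continuous.codiff {X : Type*} [TopologicalSpace X] {q : ℕ} {F : (Fin (q + 1) → X) → E}
    (hF : Continuous F) : Continuous (AlignedCochains.codiff F) :=
  continuous_finsetSum _ fun i _ => Continuous.const_smul (hF.comp (continuous_face q i)) _

theorem codiff_equivariant {X : Type*} {ρ : G →* (E ≃ₗᵢ[ℝ] E)} {act : G → X → X} {q : ℕ} {g : G}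
    {F F' : (Fin (q + 1) → X) → E} (h : ∀ x, F' (fun i => act g (x i)) = ρ g (F x))
    (x : Fin (q + 2) → X) : codiff F' (fun i => act g (x i)) = ρ g (codiff F x) := by
  unfold codiff
  rw [map_sum]
  refine Finset.sum_congr rfl fun i _ => ?_
  rw [map_smul, ← h]
  rfl

theorem shift_equivariant {X : Type*} {ρ : G →* (E ≃ₗᵢ[ℝ] E)} {act : G → X → X} {q : ℕ} {g : G}
    {F F' : (Fin (q + 2) → X) → E} (h : ∀ x, F' (fun i => act g (x i)) = ρ g (F x)) (a : X)
    (x : Fin (q + 1) → X) : shift (act g a) F' (fun i => act g (x i)) = ρ g (shift a F x) := by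
  unfold shift
  rw [← h]
  congr 1
  funext i
  cases i using Fin.cases <;> rfl

/-- A homotopy from `Θ` to the identity. -/
def homotopy (Θ : ∀ q, ((Fin (q + 1) → Y) → E) → ((Fin (q + 1) → Y) → E)) :
    ∀ q, ((Fin (q + 2) → Y) → E) → ((Fin (q + 1) → Y) → E)
  | 0, F => fun y => shift (y 0) F y - Θ 0 (shift (y 0) F) y
  | q + 1, F => fun y => shift (y 0) F y - Θ (q + 1) (shift (y 0) F) y -
      codiff (homotopy Θ q (shift (y 0) F)) y

variable {ρ : G →* (E ≃ₗᵢ[ℝ] E)} {act : G → Y → Y}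
  {Θ : ∀ q, ((Fin (q + 1) → Y) → E) → ((Fin (q + 1) → Y) → E)}

theorem IsCochainMap.continuous_apply {X : Type u} [TopologicalSpace X] {actX : G → X → X}
    {Θ : ∀ q, ((Fin (q + 1) → X) → E) → ((Fin (q + 1) → Y) → E)}
    (h : IsCochainMap ρ actX act Θ) {q : ℕ} {F : (Fin (q + 1) → X) → E} (hF : Continuous F) :
    Continuous (Θ q F) :=
  (h.continuous q PUnit (fun _ => F) (hF.comp continuous_snd)).comp
    (continuous_const (y := PUnit.unit) |>.prodMk continuous_id)

theorem continuous_homotopy (h : IsCochainMap ρ act act Θ) (q : ℕ) :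
    ∀ (Z : Type u) [TopologicalSpace Z] (F : Z → (Fin (q + 2) → Y) → E),
    Continuous (fun p : Z × (Fin (q + 2) → Y) => F p.1 p.2) →
    Continuous fun p : Z × (Fin (q + 1) → Y) => homotopy Θ q (F p.1) p.2 := by
  have key : ∀ (q : ℕ) (Z : Type u) [TopologicalSpace Z] (F : Z → (Fin (q + 2) → Y) → E),
      Continuous (fun p : Z × (Fin (q + 2) → Y) => F p.1 p.2) →
      Continuous fun p : Z × (Fin (q + 1) → Y) =>
        shift (p.2 0) (F p.1) p.2 - Θ q (shift (p.2 0) (F p.1)) p.2 := by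
    intro q Z _ F hF
    have h1 := continuous_shift hF
    have h2 := h.continuous q (Z × Y) (fun p => shift p.2 (F p.1)) h1
    have h3 : Continuous fun p : Z × (Fin (q + 1) → Y) => ((p.1, p.2 0), p.2) := by fun_prop
    exact (h1.comp h3).sub (h2.comp h3)
  induction q with
  | zero => exact fun Z _ F hF => key 0 Z F hF
  | succ q ih =>
    intro Z _ F hF
    have h2 := continuous_codiff (F := fun p : Z × Y => homotopy Θ q (shift p.2 (F p.1)))
      (ih (Z × Y) (fun p => shift p.2 (F p.1)) (continuous_shift hF))
    have h3 : Continuous fun p : Z × (Fin (q + 2) → Y) => ((p.1, p.2 0), p.2) := by fun_prop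
    exact (key _ Z F hF).sub (h2.comp h3)

theorem continuous_homotopy_apply (h : IsCochainMap ρ act act Θ) {q : ℕ}
    {F : (Fin (q + 2) → Y) → E} (hF : Continuous F) : Continuous (homotopy Θ q F) :=
  (continuous_homotopy h q PUnit (fun _ => F) (hF.comp continuous_snd)).comp
    (continuous_const (y := PUnit.unit) |>.prodMk continuous_id)

theorem homotopy_sub (h : IsCochainMap ρ act act Θ) (q : ℕ) {F F' : (Fin (q + 2) → Y) → E}
    (hF : Continuous F) (hF' : Continuous F') :
    homotopy Θ q (F - F') = homotopy Θ q F - homotopy Θ q F' := by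
  have hs : ∀ {q} (a : Y) (F F' : (Fin (q + 2) → Y) → E),
      shift a (F - F') = shift a F - shift a F' := fun _ _ _ => rfl
  induction q with
  | zero =>
    funext y
    simp only [homotopy, hs, Pi.sub_apply]
    rw [h.sub _ _ _ (continuous_shift_apply hF _) (continuous_shift_apply hF' _), Pi.sub_apply]
    abel
  | succ q ih =>
    funext y
    simp only [homotopy, hs, Pi.sub_apply]
    rw [h.sub _ _ _ (continuous_shift_apply hF _) (continuous_shift_apply hF' _), Pi.sub_apply,
      ih (continuous_shift_apply hF _) (continuous_shift_apply hF' _), codiff_sub, Pi.sub_apply]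
    abel

theorem homotopy_codiff_zero (h : IsCochainMap ρ act act Θ) {F : (Fin 1 → Y) → E}
    (hF : Continuous F) : homotopy Θ 0 (codiff F) = F - Θ 0 F := by
  funext y
  simp only [homotopy, shift_codiff_zero, Pi.sub_apply]
  rw [h.sub _ _ _ hF continuous_const, h.const, Pi.sub_apply]
  abel

/-- Freezing `a = y 0` turns `codiff F` into `F - codiff (shift a F)`. The induction hypothesis for
`shift a F` cancels the correction terms, because `codiff` squares to zero. -/
theorem homotopy_codiff (h : IsCochainMap ρ act act Θ) (q : ℕ) {F : (Fin (q + 2) → Y) → E}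
    (hF : Continuous F) :
    homotopy Θ (q + 1) (codiff F) = F - Θ (q + 1) F - codiff (homotopy Θ q F) := by
  induction q with
  | zero =>
    funext y
    have hs := continuous_shift_apply hF (y 0)
    simp only [homotopy.eq_2, shift_codiff, Pi.sub_apply]
    rw [h.sub _ _ _ hF (Continuous.codiff hs), homotopy_sub h _ hF (Continuous.codiff hs),
      homotopy_codiff_zero h hs, codiff_sub, codiff_sub, h.codiff _ _ hs]
    simp only [Pi.sub_apply]
    abel
  | succ q ih =>
    funext y
    have hs := continuous_shift_apply hF (y 0)
    rw [homotopy.eq_2]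
    simp only [shift_codiff, Pi.sub_apply]
    rw [h.sub _ _ _ hF (Continuous.codiff hs), homotopy_sub h _ hF (Continuous.codiff hs),
      ih hs, codiff_sub, codiff_sub, codiff_sub, h.codiff _ _ hs, codiff_codiff]
    simp only [Pi.sub_apply, Pi.zero_apply]
    abel

theorem norm_shift_le {X E : Type*} [NormedAddCommGroup E] {q : ℕ} {F : (Fin (q + 2) → X) → E} {K : ℝ}
    (hK : ∀ x, ‖F x‖ ≤ K) (a : X) (x : Fin (q + 1) → X) : ‖shift a F x‖ ≤ K := hK _

theorem exists_bound_homotopy (h : IsCochainMap ρ act act Θ) (q : ℕ) :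
    ∃ C, ∀ F K, Continuous F → (∀ x, ‖F x‖ ≤ K) → ∀ y, ‖homotopy Θ q F y‖ ≤ C * K := by
  induction q with
  | zero =>
    obtain ⟨C, hC⟩ := h.bound 0
    refine ⟨1 + C, fun F K hF hK y => ?_⟩
    have h1 := hC _ K (continuous_shift_apply hF (y 0)) (norm_shift_le hK _) y
    have h2 := norm_shift_le hK (y 0) y
    refine (norm_sub_le _ _).trans ?_
    linarith
  | succ q ih =>
    obtain ⟨C, hC⟩ := h.bound (q + 1)
    obtain ⟨C', hC'⟩ := ih
    refine ⟨1 + C + (q + 2) * C', fun F K hF hK y => ?_⟩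
    have hs := continuous_shift_apply hF (y 0)
    have h1 := hC _ K hs (norm_shift_le hK _) y
    have h2 := norm_shift_le hK (y 0) y
    have h3 := norm_codiff_le (hC' _ K hs (norm_shift_le hK _)) y
    refine (norm_sub_le _ _).trans ?_
    have := norm_sub_le (shift (y 0) F y) (Θ (q + 1) (shift (y 0) F) y)
    linarith

theorem homotopy_equivariant (h : IsCochainMap ρ act act Θ) (q : ℕ) (g : G)
    {F F' : (Fin (q + 2) → Y) → E} (hF : ∀ x, F' (fun i => act g (x i)) = ρ g (F x))
    (y : Fin (q + 1) → Y) : homotopy Θ q F' (fun i => act g (y i)) = ρ g (homotopy Θ q F y) := by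
  induction q with
  | zero =>
    have hs := shift_equivariant hF (y 0)
    simp only [homotopy]
    rw [hs, h.equivariant _ _ _ _ hs, map_sub]
  | succ q ih =>
    have hs := shift_equivariant hF (y 0)
    simp only [homotopy]
    rw [hs, h.equivariant _ _ _ _ hs, map_sub, map_sub]
    congr 1
    exact codiff_equivariant (fun x => ih hs x) y

end Homotopy

/-! ### Averages over compact open sets -/

section Average

open MeasureTheory Filter Topology

variable {G : Type*} [Group G] [TopologicalSpace G] [IsTopologicalGroup G] [LocallyCompactSpace G]
  [MeasurableSpace G] [BorelSpace G] {E : Type*} [NormedAddCommGroup E] [NormedSpace ℝ E]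
  {U : Set G}

/-- The average over `U` with respect to a left Haar measure. -/
def haarAverage (U : Set G) (φ : G → E) : E := ⨍ x in U, φ x ∂(Measure.haar : Measure G)

theorem haarAverage_eq (U : Set G) (φ : G → E) : haarAverage U φ =
    ((Measure.haar : Measure G).real U)⁻¹ • ∫ x in U, φ x ∂(Measure.haar : Measure G) :=
  setAverage_eq _ _ _

theorem integrableOn_haar {E : Type*} [NormedAddCommGroup E] (hc : IsCompact U) (ho : IsOpen U) {φ : G → E} (hφ : Continuous φ) :
    IntegrableOn φ U (Measure.haar : Measure G) :=
  hφ.continuousOn.integrableOn_compact' hc ho.measurableSet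

theorem haarAverage_sub (hc : IsCompact U) (ho : IsOpen U) {φ ψ : G → E} (hφ : Continuous φ)
    (hψ : Continuous ψ) : haarAverage U (φ - ψ) = haarAverage U φ - haarAverage U ψ := by
  simp only [haarAverage_eq, Pi.sub_apply]
  rw [integral_sub (integrableOn_haar hc ho hφ) (integrableOn_haar hc ho hψ), smul_sub]

theorem haarAverage_smul (U : Set G) (c : ℝ) (φ : G → E) :
    haarAverage U (c • φ) = c • haarAverage U φ := by
  simp only [haarAverage_eq, Pi.smul_apply]
  rw [integral_smul, smul_comm]

theorem haar_real_pos (hc : IsCompact U) (ho : IsOpen U) (hne : U.Nonempty) :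
    0 < (Measure.haar : Measure G).real U :=
  ENNReal.toReal_pos (ho.measure_pos _ hne).ne' hc.measure_lt_top.ne

theorem haarAverage_const [CompleteSpace E] (hc : IsCompact U) (ho : IsOpen U) (hne : U.Nonempty)
    (e : E) : haarAverage U (fun _ => e) = e := by
  rw [haarAverage_eq, setIntegral_const, smul_smul, inv_mul_cancel₀ (haar_real_pos hc ho hne).ne',
    one_smul]

theorem norm_haarAverage_le (hc : IsCompact U) (ho : IsOpen U) (hne : U.Nonempty) {φ : G → E}
    {K : ℝ} (hK : ∀ x ∈ U, ‖φ x‖ ≤ K) : ‖haarAverage U φ‖ ≤ K := by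
  have hp := haar_real_pos hc ho hne
  rw [haarAverage_eq, norm_smul, norm_inv, Real.norm_of_nonneg hp.le, inv_mul_le_iff₀ hp, mul_comm]
  exact norm_setIntegral_le_of_norm_le_const hc.measure_lt_top hK

/-- Compactness of `U` makes `φ z` uniformly close to `φ z₀` on `U`, and averaging does not increase
the sup norm. -/
theorem continuous_haarAverage (hc : IsCompact U) (ho : IsOpen U) (hne : U.Nonempty) {Z : Type*}
    [TopologicalSpace Z] {φ : Z → G → E} (hφ : Continuous fun p : Z × G => φ p.1 p.2) :
    Continuous fun z => haarAverage U (φ z) := by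
  rw [continuous_iff_continuousAt]
  intro z₀
  rw [ContinuousAt, Metric.tendsto_nhds]
  intro ε hε
  have hz : ∀ z, Continuous (φ z) := fun z => hφ.comp (by fun_prop : Continuous fun x => (z, x))
  have h := hc.eventually_forall_of_forall_eventually (x₀ := z₀)
    (P := fun z x => ‖φ z x - φ z₀ x‖ < ε / 2) (fun x _ => by
      have hcont : Continuous fun p : Z × G => ‖φ p.1 p.2 - φ z₀ p.2‖ :=
        (hφ.sub ((hz z₀).comp continuous_snd)).norm
      refine hcont.continuousAt.eventually_lt continuousAt_const ?_
      simpa using half_pos hε)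
  filter_upwards [h] with z hz'
  rw [dist_eq_norm, ← haarAverage_sub hc ho (hz z) (hz z₀)]
  exact (norm_haarAverage_le hc ho hne fun x hx => (hz' x hx).le).trans_lt (half_lt_self hε)

theorem haarAverage_map (ho : IsOpen U) (A : E ≃ₗᵢ[ℝ] E) (g : G) {U' : Set G} (ho' : IsOpen U')
    (hU : ∀ x, g * x ∈ U' ↔ x ∈ U) {φ φ' : G → E} (h : ∀ x, φ' (g * x) = A (φ x)) :
    haarAverage U' φ' = A (haarAverage U φ) := by
  have hm : (Measure.haar : Measure G) U' = (Measure.haar : Measure G) U := by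
    rw [← measure_preimage_mul (Measure.haar : Measure G) g U']
    congr 1
    ext x
    exact hU x
  rw [haarAverage_eq, haarAverage_eq, measureReal_def, measureReal_def, hm, map_smul]
  congr 1
  rw [← integral_indicator ho'.measurableSet, ← integral_indicator ho.measurableSet,
    ← integral_mul_left_eq_self _ g, ← LinearIsometryEquiv.coe_toContinuousLinearEquiv,
    ← ContinuousLinearEquiv.integral_comp_comm]
  congr 1
  funext x
  by_cases hx : x ∈ U
  · rw [Set.indicator_of_mem hx, Set.indicator_of_mem ((hU x).2 hx)]
    exact h x
  · rw [Set.indicator_of_notMem hx, Set.indicator_of_notMem (fun h' => hx ((hU x).1 h')), map_zero]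

end Average

/-! ### The automorphism group of a tree -/

section Aut

open Filter Topology

variable {V : Type*} {T : SimpleGraph V}

theorem tendsto_aut {Z : Type*} {l : Filter Z} {f : Z → (T ≃g T)} {g : T ≃g T} :
    Tendsto f l (𝓝 g) ↔ ∀ v, ∀ᶠ z in l, f z v = g v := by
  let _ : TopologicalSpace V := ⊥
  have _ : DiscreteTopology V := ⟨rfl⟩
  have h : IsInducing fun (g : T ≃g T) (v : V) => g v := ⟨rfl⟩
  rw [h.tendsto_nhds_iff, tendsto_pi_nhds]
  refine forall_congr' fun v => ?_
  rw [nhds_discrete, tendsto_pure]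
  rfl

theorem eventually_apply_eq (g : T ≃g T) (v : V) : ∀ᶠ h : T ≃g T in 𝓝 g, h v = g v :=
  tendsto_aut.1 tendsto_id v

instance : IsTopologicalGroup (T ≃g T) where
  continuous_mul := by
    rw [continuous_iff_continuousAt]
    rintro ⟨g, h⟩
    rw [ContinuousAt, tendsto_aut]
    intro v
    rw [nhds_prod_eq]
    filter_upwards [(eventually_apply_eq g (h v)).prod_inl _,
      (eventually_apply_eq h v).prod_inr _] with p h1 h2
    change p.1 (p.2 v) = g (h v)
    rw [h2, h1]
  continuous_inv := by
    rw [continuous_iff_continuousAt]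
    intro g
    rw [ContinuousAt, tendsto_aut]
    intro v
    filter_upwards [eventually_apply_eq g (g.symm v)] with h h1
    change h.symm v = g.symm v
    rw [RelIso.apply_symm_apply] at h1
    rw [← h1, RelIso.symm_apply_apply]
    simp [h1]

/-- The automorphisms mapping `r` to `w`. -/
def transporter (T : SimpleGraph V) (r w : V) : Set (T ≃g T) := {g | g r = w}

theorem isOpen_transporter (r w : V) : IsOpen (transporter T r w) := by
  rw [isOpen_iff_mem_nhds]
  intro g hg
  filter_upwards [eventually_apply_eq g r] with h hh
  exact hh.trans hg

/-- Along an ultrafilter each `g v` and each `g.symm v` is eventually constant, since it stays in a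
finite sphere around `w` or `r`. Following the inverses too ensures that the limit is bijective. -/
theorem isCompact_transporter (hT : T.IsTree) (hlf : ∀ v, (T.neighborSet v).Finite) (r w : V) :
    IsCompact (transporter T r w) := by
  rw [isCompact_iff_ultrafilter_le_nhds]
  intro l hl
  have hl' : ∀ᶠ g in (l : Filter (T ≃g T)), g r = w := hl (mem_principal_self _)
  have key : ∀ (φ : (T ≃g T) → V) (S : Set V), S.Finite → (∀ᶠ g in (l : Filter _), φ g ∈ S) →
      ∃ x, ∀ᶠ g in (l : Filter _), φ g = x := by
    intro φ S hS h
    have h' : ∀ᶠ g in (l : Filter _), ∃ x ∈ S, φ g = x := h.mono fun g hg => ⟨_, hg, rfl⟩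
    have := (Ultrafilter.eventually_exists_mem_iff hS).1 h'
    obtain ⟨x, -, hx⟩ := this
    exact ⟨x, hx⟩
  have h1 : ∀ v, ∃ x, ∀ᶠ g in (l : Filter (T ≃g T)), g v = x := by
    intro v
    refine key _ _ (finite_sphere hT hlf w (T.dist r v)) (hl'.mono fun g hg => ?_)
    rw [Set.mem_ofPred_eq, ← hg, dist_map hT]
  have h2 : ∀ v, ∃ x, ∀ᶠ g in (l : Filter (T ≃g T)), g.symm v = x := by
    intro v
    refine key _ _ (finite_sphere hT hlf r (T.dist w v)) (hl'.mono fun g hg => ?_)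
    rw [Set.mem_ofPred_eq, ← hg, ← dist_map hT g, RelIso.apply_symm_apply]
  choose f hf using h1
  choose f' hf' using h2
  have hl1 : ∀ v, f' (f v) = v := by
    intro v
    obtain ⟨g, h1, h2⟩ := ((hf v).and (hf' (f v))).exists
    rw [← h2, ← h1, RelIso.symm_apply_apply]
  have hl2 : ∀ v, f (f' v) = v := by
    intro v
    obtain ⟨g, h1, h2⟩ := ((hf' v).and (hf (f' v))).exists
    rw [← h2, ← h1, RelIso.apply_symm_apply]
  refine ⟨⟨⟨f, f', hl1, hl2⟩, ?_⟩, ?_, ?_⟩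
  · intro a b
    obtain ⟨g, h1, h2⟩ := ((hf a).and (hf b)).exists
    change T.Adj (f a) (f b) ↔ T.Adj a b
    rw [← h1, ← h2, g.map_adj_iff]
  · obtain ⟨g, h1, h2⟩ := ((hf r).and hl').exists
    exact h1.symm.trans h2
  · exact tendsto_aut.2 hf

theorem locallyCompactSpace_aut (hT : T.IsTree) (hlf : ∀ v, (T.neighborSet v).Finite) :
    LocallyCompactSpace (T ≃g T) := by
  obtain ⟨v⟩ := hT.connected.nonempty
  exact (isCompact_transporter hT hlf v v).locallyCompactSpace_of_mem_nhds_of_group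
    ((isOpen_transporter v v).mem_nhds (show (1 : T ≃g T) v = v from rfl))

/-- A chosen representative of the orbit of a vertex. -/
def orbitRep (T : SimpleGraph V) (w : V) : V :=
  (Quot.mk (fun a b => ∃ g : T ≃g T, g a = b) w).out

theorem exists_orbitRep (w : V) : ∃ g : T ≃g T, g (orbitRep T w) = w := by
  have he : Equivalence (fun a b => ∃ g : T ≃g T, g a = b) :=
    ⟨fun a => ⟨1, rfl⟩, fun ⟨g, hg⟩ => ⟨g.symm, by rw [← hg, RelIso.symm_apply_apply]⟩,
      fun ⟨g, hg⟩ ⟨h, hh⟩ => ⟨h * g, by rw [← hh, ← hg]; rfl⟩⟩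
  have := Quot.eqvGen_exact (Quot.out_eq (Quot.mk (fun a b => ∃ g : T ≃g T, g a = b) w))
  rwa [he.eqvGen_iff] at this

theorem orbitRep_map (g : T ≃g T) (w : V) : orbitRep T (g w) = orbitRep T w :=
  congrArg Quot.out (Quot.sound ⟨g, rfl⟩ :
    Quot.mk (fun a b => ∃ g : T ≃g T, g a = b) w = Quot.mk _ (g w)).symm

universe u v

/-- An equivariant family, indexed by the vertices, of means for continuous functions on the
automorphism group. -/
structure IsMeanFamily {V : Type u} {T : SimpleGraph V} {E : Type v} [NormedAddCommGroup E]
    [NormedSpace ℝ E] (ρ : (T ≃g T) →* (E ≃ₗᵢ[ℝ] E)) (M : V → ((T ≃g T) → E) → E) : Prop where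
  sub : ∀ w φ ψ, Continuous φ → Continuous ψ → M w (φ - ψ) = M w φ - M w ψ
  smul : ∀ w (c : ℝ) φ, M w (c • φ) = c • M w φ
  const : ∀ w e, M w (fun _ => e) = e
  bound : ∀ w φ K, (∀ x, ‖φ x‖ ≤ K) → ‖M w φ‖ ≤ K
  equivariant : ∀ w g φ φ', (∀ x, φ' (g * x) = ρ g (φ x)) → M (g w) φ' = ρ g (M w φ)
  continuous : ∀ w (Z : Type u) [TopologicalSpace Z] (φ : Z → (T ≃g T) → E),
    Continuous (fun p : Z × (T ≃g T) => φ p.1 p.2) → Continuous fun z => M w (φ z)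

/-- The automorphisms taking the orbit representative of `w` to `w` form a left coset of its compact
open stabiliser. Left translation by `g` maps it to the coset for `g w`, which has the same
representative, so left invariance of Haar measure gives equivariance. -/
theorem exists_isMeanFamily {V : Type u} {T : SimpleGraph V} {E : Type v} [NormedAddCommGroup E]
    [NormedSpace ℝ E] [CompleteSpace E] (hT : T.IsTree) (hlf : ∀ v, (T.neighborSet v).Finite)
    (ρ : (T ≃g T) →* (E ≃ₗᵢ[ℝ] E)) : ∃ M, IsMeanFamily ρ M := by
  have _ := locallyCompactSpace_aut hT hlf
  let _ : MeasurableSpace (T ≃g T) := borel _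
  have _ : BorelSpace (T ≃g T) := ⟨rfl⟩
  have hc := fun w => isCompact_transporter hT hlf (orbitRep T w) w
  have ho := fun w => isOpen_transporter (T := T) (orbitRep T w) w
  have hne : ∀ w, (transporter T (orbitRep T w) w).Nonempty := exists_orbitRep
  refine ⟨fun w => haarAverage (transporter T (orbitRep T w) w), ⟨?_, ?_, ?_, ?_, ?_, ?_⟩⟩
  · exact fun w φ ψ => haarAverage_sub (hc w) (ho w)
  · exact fun w c φ => haarAverage_smul _ c φ
  · exact fun w e => haarAverage_const (hc w) (ho w) (hne w) e
  · exact fun w φ K hK => norm_haarAverage_le (hc w) (ho w) (hne w) fun x _ => hK x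
  · intro w g φ φ' h
    refine haarAverage_map (ho w) (ρ g) g (ho (g w)) (fun x => ?_) h
    rw [orbitRep_map]
    exact g.injective.eq_iff
  · exact fun w Z _ φ => continuous_haarAverage (hc w) (ho w) (hne w)

end Aut

/-! ### The cochain maps between the three complexes -/

section CochainMaps

universe u v w

variable {E : Type v} [NormedAddCommGroup E] [NormedSpace ℝ E]

theorem IsCochainMap.comp {G : Type w} [Group G] {X Y Z : Type u} [TopologicalSpace X]
    [TopologicalSpace Y] [TopologicalSpace Z] {ρ : G →* (E ≃ₗᵢ[ℝ] E)} {actX : G → X → X}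
    {actY : G → Y → Y} {actZ : G → Z → Z}
    {Θ : ∀ q, ((Fin (q + 1) → X) → E) → ((Fin (q + 1) → Y) → E)}
    {Ξ : ∀ q, ((Fin (q + 1) → Y) → E) → ((Fin (q + 1) → Z) → E)}
    (hΞ : IsCochainMap ρ actY actZ Ξ) (hΘ : IsCochainMap ρ actX actY Θ) :
    IsCochainMap ρ actX actZ (fun q F => Ξ q (Θ q F)) where
  sub q F F' hF hF' := by
    rw [hΘ.sub q F F' hF hF', hΞ.sub q _ _ (hΘ.continuous_apply hF) (hΘ.continuous_apply hF')]
  codiff q F hF := by rw [hΘ.codiff q F hF, hΞ.codiff q _ (hΘ.continuous_apply hF)]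
  const e := by rw [hΘ.const, hΞ.const]
  bound q := by
    obtain ⟨C, hC⟩ := hΘ.bound q
    obtain ⟨C', hC'⟩ := hΞ.bound q
    exact ⟨C' * C, fun F K hF hK z => by
      rw [mul_assoc]
      exact hC' _ _ (hΘ.continuous_apply hF) (hC F K hF hK) z⟩
  equivariant q g F F' h := hΞ.equivariant q g _ _ (hΘ.equivariant q g F F' h)
  continuous q Z _ F hF := hΞ.continuous q Z (fun z => Θ q (F z)) (hΘ.continuous q Z F hF)

variable {V : Type u} {T : SimpleGraph V} {ρ : (T ≃g T) →* (E ≃ₗᵢ[ℝ] E)}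

/-- Pull-back along the orbit map at `v`. -/
def orbitPullback (T : SimpleGraph V) (v : V) (q : ℕ) (F : (Fin (q + 1) → V) → E) :
    (Fin (q + 1) → (T ≃g T)) → E := fun g => F (fun i => g i v)

theorem isCochainMap_orbitPullback [TopologicalSpace V] [DiscreteTopology V] (v : V) :
    IsCochainMap ρ (fun g x => g x) (fun g h => g * h) (orbitPullback (E := E) T v) where
  sub _ _ _ _ _ := rfl
  codiff _ _ _ := rfl
  const _ := rfl
  bound q := ⟨1, fun F K _ hK y => by rw [one_mul]; exact hK _⟩
  equivariant q g F F' h y := h _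
  continuous q Z _ F hF := by
    refine hF.comp (continuous_fst.prodMk ?_)
    exact (continuous_pi fun i => by
      have h : Continuous fun g : T ≃g T => g v := by
        rw [continuous_iff_continuousAt]
        intro g
        rw [ContinuousAt, nhds_discrete V, Filter.tendsto_pure]
        exact eventually_apply_eq g v
      exact h.comp ((continuous_apply i).comp continuous_snd))

/-- Pull-back along the chain map to coherent chains. -/
def coherentPullback (hT : T.IsTree) (q : ℕ) (F : (Fin (q + 1) → V) → E) :
    (Fin (q + 1) → V) → E := fun x => lift F (coherentProj hT q (simplex x))

theorem lift_comp_vAct {q : ℕ} {g : T ≃g T} {F F' : (Fin (q + 1) → V) → E}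
    (h : ∀ x, F' (fun i => g (x i)) = ρ g (F x)) (z : Chain V q) :
    lift F' (chainAct q g z) = ρ g (lift F z) := by
  have : lift F' ∘ₗ chainAct q g = (ρ g).toLinearEquiv.toLinearMap ∘ₗ lift F := by
    refine chain_ext fun x => ?_
    simp only [LinearMap.comp_apply, chainAct_simplex, lift_simplex]
    exact h x
  exact LinearMap.congr_fun this z

theorem isCochainMap_coherentPullback [TopologicalSpace V] [DiscreteTopology V] (hT : T.IsTree) :
    IsCochainMap ρ (fun g x => g x) (fun g x => g x) (coherentPullback (E := E) hT) where
  sub q F F' _ _ := funext fun x => lift_sub_fun _ _ _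
  codiff q F _ := by
    funext x
    rw [codiff_eq_lift]
    unfold coherentPullback
    rw [← lift_bd, bd_coherentProj]
    have : lift F ∘ₗ coherentProj hT q = lift (fun x => lift F (coherentProj hT q (simplex x))) :=
      chain_ext fun x => by simp
    exact LinearMap.congr_fun this _
  const e := by
    funext x
    rw [coherentPullback, coherentProj_zero, lift_simplex]
  bound q := by
    obtain ⟨C, -, hC⟩ := exists_boundedBy_coherentProj hT E q
    exact ⟨C, fun F K _ hK y => hC y F K hK⟩
  equivariant q g F F' h y := by
    unfold coherentPullback
    rw [← lift_comp_vAct h, chainAct_coherentProj, chainAct_simplex]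
    rfl
  continuous q Z _ F hF := by
    rw [continuous_prod_of_discrete_right]
    intro x
    unfold coherentPullback lift
    simp only [Finsupp.linearCombination_apply, Finsupp.sum]
    refine continuous_finsetSum _ fun y _ => Continuous.const_smul ?_ _
    exact hF.comp (by fun_prop : Continuous fun z => (z, y))

/-- The averaging map from functions on the group to functions on the vertices. -/
def averaging (M : V → ((T ≃g T) → E) → E) :
    ∀ q, ((Fin (q + 1) → (T ≃g T)) → E) → ((Fin (q + 1) → V) → E)
  | 0, F => fun w => M (w 0) fun g => F fun _ => g
  -- A single variable is averaged at each stage, so no product measure is involved; applying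
  -- `codiff` to the average of one degree less is what yields a cochain map.
  | q + 1, F => fun w => M (w 0) fun g => codiff (averaging M q (shift g F)) w

variable {M : V → ((T ≃g T) → E) → E}

theorem continuous_averaging (hM : IsMeanFamily ρ M) (q : ℕ) : ∀ (Z : Type u) [TopologicalSpace Z]
    (F : Z → (Fin (q + 1) → (T ≃g T)) → E),
    Continuous (fun p : Z × (Fin (q + 1) → (T ≃g T)) => F p.1 p.2) →
    ∀ w, Continuous fun z => averaging M q (F z) w := by
  induction q with
  | zero =>
    intro Z _ F hF w
    exact hM.continuous _ Z _ (hF.comp (by fun_prop :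
      Continuous fun p : Z × (T ≃g T) => (p.1, fun _ => p.2)))
  | succ q ih =>
    intro Z _ F hF w
    refine hM.continuous _ Z _ ?_
    refine continuous_finsetSum _ fun i _ => Continuous.const_smul ?_ _
    exact ih (Z × (T ≃g T)) (fun p => shift p.2 (F p.1)) (continuous_shift hF) _

/-- The means are additive only on continuous functions, so the integrand defining `averaging` has
to be continuous in `g`. -/
theorem continuous_averaging_shift (hM : IsMeanFamily ρ M) {q : ℕ}
    {F : (Fin (q + 2) → (T ≃g T)) → E} (hF : Continuous F) (w : Fin (q + 2) → V) :
    Continuous fun g => codiff (averaging M q (shift g F)) w := by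
  refine continuous_finsetSum _ fun i _ => Continuous.const_smul ?_ _
  refine continuous_averaging hM q (T ≃g T) (fun g => shift g F) ?_ _
  have := continuous_shift (Z := PUnit.{1}) (F := fun _ => F) (hF.comp continuous_snd)
  exact this.comp (by fun_prop : Continuous fun p : (T ≃g T) × (Fin (q + 1) → (T ≃g T)) =>
    ((PUnit.unit.{1}, p.1), p.2))

theorem averaging_sub (hM : IsMeanFamily ρ M) (q : ℕ) {F F' : (Fin (q + 1) → (T ≃g T)) → E}
    (hF : Continuous F) (hF' : Continuous F') :
    averaging M q (F - F') = averaging M q F - averaging M q F' := by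
  induction q with
  | zero =>
    funext w
    have hc : Continuous fun (g : T ≃g T) (_ : Fin 1) => g := by fun_prop
    exact hM.sub _ _ _ (hF.comp hc) (hF'.comp hc)
  | succ q ih =>
    funext w
    have hs : ∀ g, shift g (F - F') = shift g F - shift g F' := fun _ => rfl
    simp only [averaging, hs, Pi.sub_apply]
    rw [← hM.sub _ _ _ (continuous_averaging_shift hM hF w) (continuous_averaging_shift hM hF' w)]
    congr 1
    funext g
    rw [ih (continuous_shift_apply hF g) (continuous_shift_apply hF' g), codiff_sub]
    rfl

theorem averaging_smul (hM : IsMeanFamily ρ M) (q : ℕ) (c : ℝ)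
    (F : (Fin (q + 1) → (T ≃g T)) → E) : averaging M q (c • F) = c • averaging M q F := by
  induction q with
  | zero => funext w; exact hM.smul _ c _
  | succ q ih =>
    funext w
    have hs : ∀ g, shift g (c • F) = c • shift g F := fun _ => rfl
    simp only [averaging, hs, Pi.smul_apply]
    rw [← hM.smul]
    congr 1
    funext g
    rw [ih]
    simp only [codiff, Pi.smul_apply, Finset.smul_sum]
    exact Finset.sum_congr rfl fun i _ => smul_comm _ _ _

theorem averaging_const (hM : IsMeanFamily ρ M) (e : E) :
    averaging M 0 (fun _ => e) = fun _ => e := funext fun _ => hM.const _ e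

theorem codiff_const {Y : Type*} (e : E) : codiff (fun _ : Fin 1 → Y => e) = 0 := by
  funext x
  simp [codiff, Fin.sum_univ_succ]

/-- For each `g` the integrand reduces to `codiff (averaging M q F)`, the remaining term dying by
`codiff_codiff` (or `codiff_const` in degree zero). It no longer depends on `g`, and a mean fixes
constants. -/
theorem averaging_codiff (hM : IsMeanFamily ρ M) (q : ℕ) {F : (Fin (q + 1) → (T ≃g T)) → E}
    (hF : Continuous F) : averaging M (q + 1) (codiff F) = codiff (averaging M q F) := by
  induction q with
  | zero =>
    funext w
    have : ∀ g : T ≃g T, codiff (averaging M 0 (shift g (codiff F))) =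
        codiff (averaging M 0 F) := by
      intro g
      rw [shift_codiff_zero, averaging_sub hM 0 hF continuous_const, averaging_const hM,
        codiff_sub, codiff_const, sub_zero]
    exact (congrArg (M (w 0)) (funext fun g => congrFun (this g) w)).trans (hM.const _ _)
  | succ q ih =>
    funext w
    rw [averaging]
    have : ∀ g : T ≃g T, codiff (averaging M (q + 1) (shift g (codiff F))) =
        codiff (averaging M (q + 1) F) := by
      intro g
      have hs := continuous_shift_apply hF g
      rw [shift_codiff, averaging_sub hM _ hF (Continuous.codiff hs), ih hs, codiff_sub,
        codiff_codiff, sub_zero]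
    simp only [this]
    exact hM.const _ _

theorem exists_bound_averaging (hM : IsMeanFamily ρ M) (q : ℕ) :
    ∃ C, ∀ (F : (Fin (q + 1) → (T ≃g T)) → E) K, (∀ x, ‖F x‖ ≤ K) →
      ∀ w, ‖averaging M q F w‖ ≤ C * K := by
  induction q with
  | zero => exact ⟨1, fun F K hK w => by rw [one_mul]; exact hM.bound _ _ _ fun g => hK _⟩
  | succ q ih =>
    obtain ⟨C, hC⟩ := ih
    refine ⟨(q + 2) * C, fun F K hK w => hM.bound _ _ _ fun g => ?_⟩
    rw [mul_assoc]
    exact norm_codiff_le (hC _ K (norm_shift_le hK g)) w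

theorem averaging_equivariant (hM : IsMeanFamily ρ M) (q : ℕ) (g : T ≃g T)
    {F F' : (Fin (q + 1) → (T ≃g T)) → E} (h : ∀ x, F' (fun i => g * x i) = ρ g (F x))
    (w : Fin (q + 1) → V) : averaging M q F' (fun i => g (w i)) = ρ g (averaging M q F w) := by
  induction q with
  | zero => exact hM.equivariant _ _ _ _ fun x => h _
  | succ q ih =>
    refine hM.equivariant _ _ _ _ fun x => ?_
    have hs := shift_equivariant (act := fun g x => g * x) h x
    exact codiff_equivariant (act := fun (g : T ≃g T) v => g v) (fun y => ih hs y) w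

theorem isCochainMap_averaging [TopologicalSpace V] [DiscreteTopology V] (hM : IsMeanFamily ρ M) :
    IsCochainMap ρ (fun g h => g * h) (fun g x => g x) (averaging M) where
  sub q _ _ := averaging_sub hM q
  codiff q _ := averaging_codiff hM q
  const := averaging_const hM
  bound q := by
    obtain ⟨C, hC⟩ := exists_bound_averaging hM q
    exact ⟨C, fun F K _ => hC F K⟩
  equivariant q g _ _ h := averaging_equivariant hM q g h
  continuous q Z _ F hF := by
    rw [continuous_prod_of_discrete_right]
    exact continuous_averaging hM q Z F hF

end CochainMaps

/-! ### Comparison of the cohomologies -/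

section Comparison

theorem Cohomology.map_map {C D : ℕ → Type*} [∀ n, NormedAddCommGroup (C n)]
    [∀ n, NormedSpace ℝ (C n)] [∀ n, NormedAddCommGroup (D n)] [∀ n, NormedSpace ℝ (D n)]
    {d : ∀ n, C n →L[ℝ] C (n + 1)} {d' : ∀ n, D n →L[ℝ] D (n + 1)} {f : ∀ n, C n →L[ℝ] D n}
    {g : ∀ n, D n →L[ℝ] C n} {hf : ∀ n x, f (n + 1) (d n x) = d' n (f n x)}
    {hg : ∀ n x, g (n + 1) (d' n x) = d n (g n x)} (n : ℕ)
    (h : ∀ z, d n z = 0 → g n (f n z) - z ∈ coboundaries d n) (c : Cohomology d n) :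
    Cohomology.map g hg n (Cohomology.map f hf n c) = c := by
  obtain ⟨⟨z, hz⟩, rfl⟩ := Submodule.Quotient.mk_surjective _ c
  exact (Submodule.Quotient.eq _).2 (h z hz)

/-- A bounded linear map into a space of bounded functions, given pointwise. -/
def boundedOp {E : Type*} [NormedAddCommGroup E] [NormedSpace ℝ E] {W : Type*}
    [NormedAddCommGroup W] [NormedSpace ℝ W] {Y : Type*} (S : Submodule ℝ (LInf Y E))
    (L : W → Y → E) (hadd : ∀ a b, L (a + b) = L a + L b)
    (hsmul : ∀ (c : ℝ) a, L (c • a) = c • L a) (hb : ∃ C, ∀ a y, ‖L a y‖ ≤ C * ‖a‖)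
    (hmem : ∀ a (α : LInf Y E), (∀ y, α y = L a y) → α ∈ S) : W →L[ℝ] S :=
  LinearMap.mkContinuous
    { toFun := fun a => ⟨mkLInf (L a) _ (hb.choose_spec a), hmem a _ fun _ => rfl⟩
      map_add' := fun a b => by
        apply Subtype.ext
        ext y
        exact congrFun (hadd a b) y
      map_smul' := fun c a => by
        apply Subtype.ext
        ext y
        exact congrFun (hsmul c a) y } |hb.choose|
    -- The constant in `hb` has no prescribed sign; its absolute value supplies the nonnegative
    -- bound needed for the sup norm.
    (fun a => lp.norm_le_of_forall_le (mul_nonneg (abs_nonneg _) (norm_nonneg _)) fun y =>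
      (hb.choose_spec a y).trans (mul_le_mul_of_nonneg_right (le_abs_self _) (norm_nonneg _)))

universe u v

variable {V : Type u} {T : SimpleGraph V} {E : Type v} [NormedAddCommGroup E] [NormedSpace ℝ E]
  {ρ : (T ≃g T) →* (E ≃ₗᵢ[ℝ] E)}

theorem vDiff_apply {q : ℕ} (α : vCochains ρ q) (x : Fin (q + 2) → V) :
    (vDiff ρ q α).1 x = codiff (fun y => α.1 y) x := diff_apply _ α.1 x

theorem cbDiff_apply {q : ℕ} (f : cbCochains ρ q) (x : Fin (q + 2) → (T ≃g T)) :
    (cbDiff ρ q f).1 x = codiff (fun y => f.1 y) x := diff_apply _ f.1 x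

/-- The homotopy applied to a cocycle `z` is a primitive of `z - Θ z`, whence the change of sign; it
is an invariant cochain because the homotopy is equivariant. In degree zero the two cochains
coincide. -/
theorem vCochains_sub_mem_coboundaries [TopologicalSpace V] [DiscreteTopology V]
    {Θ : ∀ q, ((Fin (q + 1) → V) → E) → ((Fin (q + 1) → V) → E)}
    (h : IsCochainMap ρ (fun g x => g x) (fun g x => g x) Θ) {q : ℕ} {z w : vCochains ρ q}
    (hz : vDiff ρ q z = 0) (hw : ∀ x, w.1 x = Θ q (fun y => z.1 y) x) :
    w - z ∈ coboundaries (vDiff ρ) q := by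
  have hd : codiff (fun y => z.1 y) = 0 := by
    funext x
    rw [← vDiff_apply, hz]
    rfl
  have h0 : ∀ q, homotopy Θ q 0 = 0 := fun q => by
    have := homotopy_sub h q (F := 0) (F' := 0) continuous_const continuous_const
    rwa [sub_zero, sub_self] at this
  rw [← Submodule.neg_mem_iff, neg_sub]
  cases q with
  | zero =>
    have h1 := homotopy_codiff_zero h (F := fun y => z.1 y) continuous_of_discreteTopology
    rw [hd, h0, eq_comm, sub_eq_zero] at h1
    change z - w = 0
    rw [sub_eq_zero]
    apply Subtype.ext
    ext x
    rw [hw, ← h1]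
  | succ q =>
    have h1 := homotopy_codiff h q (F := fun y => z.1 y) continuous_of_discreteTopology
    rw [hd, h0, eq_comm, sub_eq_zero] at h1
    obtain ⟨C, hC⟩ := exists_bound_homotopy h q
    have hb := hC (fun y => z.1 y) ‖z.1‖ continuous_of_discreteTopology (norm_apply_le z.1)
    refine ⟨⟨mkLInf _ _ hb, fun g x => homotopy_equivariant h q g (fun y => z.2 g y) x⟩, ?_⟩
    apply Subtype.ext
    ext x
    change (vDiff ρ q _).1 x = z.1 x - w.1 x
    rw [vDiff_apply, hw]
    exact (congrFun h1 x).symm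

theorem cbCochains_sub_mem_coboundaries
    {Θ : ∀ q, ((Fin (q + 1) → (T ≃g T)) → E) → ((Fin (q + 1) → (T ≃g T)) → E)}
    (h : IsCochainMap ρ (fun g x => g * x) (fun g x => g * x) Θ) {q : ℕ} {z w : cbCochains ρ q}
    (hz : cbDiff ρ q z = 0) (hw : ∀ x, w.1 x = Θ q (fun y => z.1 y) x) :
    w - z ∈ coboundaries (cbDiff ρ) q := by
  have hd : codiff (fun y => z.1 y) = 0 := by
    funext x
    rw [← cbDiff_apply, hz]
    rfl
  have h0 : ∀ q, homotopy Θ q 0 = 0 := fun q => by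
    have := homotopy_sub h q (F := 0) (F' := 0) continuous_const continuous_const
    rwa [sub_zero, sub_self] at this
  rw [← Submodule.neg_mem_iff, neg_sub]
  cases q with
  | zero =>
    have h1 := homotopy_codiff_zero h (F := fun y => z.1 y) z.2.1
    rw [hd, h0, eq_comm, sub_eq_zero] at h1
    change z - w = 0
    rw [sub_eq_zero]
    apply Subtype.ext
    ext x
    rw [hw, ← h1]
  | succ q =>
    have h1 := homotopy_codiff h q (F := fun y => z.1 y) z.2.1
    rw [hd, h0, eq_comm, sub_eq_zero] at h1
    obtain ⟨C, hC⟩ := exists_bound_homotopy h q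
    have hb := hC (fun y => z.1 y) ‖z.1‖ z.2.1 (norm_apply_le z.1)
    refine ⟨⟨mkLInf _ _ hb, continuous_homotopy_apply h z.2.1,
      fun g x => homotopy_equivariant h q g (fun y => z.2.2 g y) x⟩, ?_⟩
    apply Subtype.ext
    ext x
    change (cbDiff ρ q _).1 x = z.1 x - w.1 x
    rw [cbDiff_apply, hw]
    exact (congrFun h1 x).symm

/-! ### Mutually inverse maps on cohomology -/

variable {M : V → ((T ≃g T) → E) → E}

theorem averaging_add (hM : IsMeanFamily ρ M) (q : ℕ) {F F' : (Fin (q + 1) → (T ≃g T)) → E}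
    (hF : Continuous F) (hF' : Continuous F') :
    averaging M q (F + F') = averaging M q F + averaging M q F' := by
  have h1 := averaging_sub hM q hF (hF'.const_smul (-1 : ℝ))
  have h2 := averaging_smul hM q (-1 : ℝ) F'
  rw [h2] at h1
  simpa using h1

/-- The averaging map `C_b(G^{q+1}, E)^G → ℓ^∞(V^{q+1}, E)^G`. -/
def averagingMap (hM : IsMeanFamily ρ M) (q : ℕ) : cbCochains ρ q →L[ℝ] vCochains ρ q :=
  boundedOp (vCochains ρ q) (fun f => averaging M q fun x => f.1 x)
    (fun a b => averaging_add hM q a.2.1 b.2.1)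
    (fun c a => averaging_smul hM q c _)
    (by
      obtain ⟨C, hC⟩ := exists_bound_averaging hM q
      exact ⟨C, fun f => hC _ _ (norm_apply_le f.1)⟩)
    (fun f α hα g x => by
      rw [hα, hα]
      exact averaging_equivariant hM q g (fun y => f.2.2 g y) x)

theorem averagingMap_apply (hM : IsMeanFamily ρ M) {q : ℕ} (f : cbCochains ρ q)
    (x : Fin (q + 1) → V) : (averagingMap hM q f).1 x = averaging M q (fun y => f.1 y) x := rfl

/-- The map induced by averaging on cohomology. -/
def averagingH (hM : IsMeanFamily ρ M) (q : ℕ) : Hcb ρ q →L[ℝ] HV ρ q :=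
  Cohomology.map (d := cbDiff ρ) (d' := vDiff ρ) (averagingMap hM) (fun n f => by
    apply Subtype.ext
    ext x
    rw [vDiff_apply, averagingMap_apply]
    have : (fun y => (cbDiff ρ n f).1 y) = codiff (fun y => f.1 y) := funext (cbDiff_apply f)
    rw [this, averaging_codiff hM n f.2.1]
    rfl) q

theorem averagingH_orbitH (hM : IsMeanFamily ρ M) (v : V) (q : ℕ) (c : HV ρ q) :
    averagingH hM q (orbitH ρ v q c) = c := by
  let _ : TopologicalSpace V := ⊥
  have _ : DiscreteTopology V := ⟨rfl⟩
  exact Cohomology.map_map q (fun z hz => vCochains_sub_mem_coboundaries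
    ((isCochainMap_averaging hM).comp (isCochainMap_orbitPullback v)) hz fun x => rfl) c

theorem orbitH_averagingH (hM : IsMeanFamily ρ M) (v : V) (q : ℕ) (c : Hcb ρ q) :
    orbitH ρ v q (averagingH hM q c) = c := by
  let _ : TopologicalSpace V := ⊥
  have _ : DiscreteTopology V := ⟨rfl⟩
  exact Cohomology.map_map q (fun z hz => cbCochains_sub_mem_coboundaries
    ((isCochainMap_orbitPullback v).comp (isCochainMap_averaging hM)) hz fun x => rfl) c

/-- The extension map `ℓ^∞_+(coh^{q+1}, E)^G → ℓ^∞(V^{q+1}, E)^G`. -/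
def extendMap (hT : T.IsTree) (ρ : (T ≃g T) →* (E ≃ₗᵢ[ℝ] E)) (q : ℕ) :
    plusInv ρ q →L[ℝ] vCochains ρ q :=
  boundedOp (vCochains ρ q) (fun α => coherentPullback hT q (extendZero α.1))
    (fun a b => by
      funext x
      have h : extendZero (a + b).1 = extendZero a.1 + extendZero b.1 := extendZero_add a.1 b.1
      unfold coherentPullback
      rw [h, lift_add_fun]
      rfl)
    (fun c a => by
      funext x
      have h : extendZero (c • a).1 = c • extendZero a.1 := extendZero_smul c a.1
      unfold coherentPullback
      rw [h, lift_smul_fun]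
      rfl)
    (by
      obtain ⟨C, -, hC⟩ := exists_boundedBy_coherentProj hT E q
      exact ⟨C, fun α x => hC x _ _ (norm_extendZero_le α.1)⟩)
    (fun α β hβ g x => by
      rw [hβ, hβ]
      unfold coherentPullback
      rw [← lift_comp_vAct (fun y => extendZero_vAct α.2.2 g y), chainAct_coherentProj,
        chainAct_simplex])

theorem extendMap_apply (hT : T.IsTree) {q : ℕ} (α : plusInv ρ q) (x : Fin (q + 1) → V) :
    (extendMap hT ρ q α).1 x = lift (extendZero α.1) (coherentProj hT q (simplex x)) := rfl

/-- The map induced by extension on cohomology. -/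
def extendH (hT : T.IsTree) (ρ : (T ≃g T) →* (E ≃ₗᵢ[ℝ] E)) (q : ℕ) : HCoh ρ q →L[ℝ] HV ρ q :=
  Cohomology.map (extendMap hT ρ) (fun n α => by
    apply Subtype.ext
    ext x
    rw [vDiff_apply, extendMap_apply, codiff_eq_lift]
    change lift (extendZero (cohDiff T E n α.1)) _ = _
    rw [lift_extendZero_cohDiff _ (coherentProj_mem hT _ _), bd_coherentProj]
    have : lift (extendZero α.1) ∘ₗ coherentProj hT n = lift fun y => (extendMap hT ρ n α).1 y :=
      chain_ext fun y => by
        rw [LinearMap.comp_apply, lift_simplex, extendMap_apply]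
    exact LinearMap.congr_fun this _) q

/-- No homotopy is needed: on coherent tuples `coherentProj` is `antisym`, which cochains in the
`+1` eigenspace do not see. -/
theorem compH_extendH (hT : T.IsTree) (q : ℕ) (c : HCoh ρ q) :
    compH ρ q (extendH hT ρ q c) = c := by
  refine Cohomology.map_map q (fun α _ => ?_) c
  have : compMap ρ q (extendMap hT ρ q α) = α := by
    apply Subtype.ext
    have h : rest T q (extendMap hT ρ q α).1 = α.1 := by
      ext x
      rw [LInf.comp_apply, extendMap_apply, coherentProj_of_isCoherent hT x.2,
        lift_antisym_of_mem_plus hT α.2.1 (Finsupp.single_mem_supported _ _ x.2), lift_simplex,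
        extendZero_of_isCoherent _ x.2]
    change projA T E q (rest T q (extendMap hT ρ q α).1) = α.1
    rw [h, projA_of_mem_plus α.2.1]
  rw [this, sub_self]
  exact Submodule.zero_mem _

/-- On cochains the composite is `coherentPullback`: the projection `A_q` contributes an extra
`antisym`, absorbed by `antisym_coherentProj`. -/
theorem extendH_compH (hT : T.IsTree) (q : ℕ) (c : HV ρ q) :
    extendH hT ρ q (compH ρ q c) = c := by
  let _ : TopologicalSpace V := ⊥
  have _ : DiscreteTopology V := ⟨rfl⟩
  refine Cohomology.map_map q (fun z hz => vCochains_sub_mem_coboundaries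
    (isCochainMap_coherentPullback hT) hz fun x => ?_) c
  rw [extendMap_apply]
  change lift (extendZero (projA T E q (rest T q z.1))) _ = _
  rw [lift_extendZero_projA_rest hT _ (coherentProj_mem hT _ _), antisym_coherentProj]
  rfl

/-- The orbit map at `v` is an isomorphism on cohomology. -/
def orbitEquiv (hM : IsMeanFamily ρ M) (v : V) (q : ℕ) : HV ρ q ≃L[ℝ] Hcb ρ q :=
  ContinuousLinearEquiv.equivOfInverse (orbitH ρ v q) (averagingH hM q)
    (averagingH_orbitH hM v q) (orbitH_averagingH hM v q)

/-- Restriction to coherent tuples is an isomorphism on cohomology. -/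
def compEquiv (hT : T.IsTree) (ρ : (T ≃g T) →* (E ≃ₗᵢ[ℝ] E)) (q : ℕ) : HV ρ q ≃L[ℝ] HCoh ρ q :=
  ContinuousLinearEquiv.equivOfInverse (compH ρ q) (extendH hT ρ q)
    (extendH_compH hT q) (compH_extendH hT q)

theorem isHomeomorph_orbitH (hM : IsMeanFamily ρ M) (v : V) (q : ℕ) :
    IsHomeomorph (orbitH ρ v q) := (orbitEquiv hM v q).toHomeomorph.isHomeomorph

theorem exists_equiv_orbitH [CompleteSpace E] (hT : T.IsTree)
    (hlf : ∀ v, (T.neighborSet v).Finite) (ρ : (T ≃g T) →* (E ≃ₗᵢ[ℝ] E)) (q : ℕ) :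
    ∃ Φ : Hcb ρ q ≃L[ℝ] HCoh ρ q, ∀ v : V, IsHomeomorph (orbitH ρ v q) ∧
      ∀ c, Φ (orbitH ρ v q c) = compH ρ q c := by
  obtain ⟨M, hM⟩ := exists_isMeanFamily hT hlf ρ
  obtain ⟨v₀⟩ := hT.connected.nonempty
  -- The inverse `averagingH` involves no vertex and inverts `orbitH ρ v q` for every `v`, so a
  -- single isomorphism serves all vertices.
  exact ⟨(orbitEquiv hM v₀ q).symm.trans (compEquiv hT ρ q),
    fun v => ⟨isHomeomorph_orbitH hM v q, fun c =>
      congrArg (compH ρ q) (averagingH_orbitH hM v q c)⟩⟩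

end Comparison

/-! ### Exactness of the coherent complex -/

section Exactness

variable {V : Type*} {T : SimpleGraph V} {E : Type*} [NormedAddCommGroup E] [NormedSpace ℝ E]

theorem plusAug_injective (hT : T.IsTree) : Function.Injective (plusAug T E) := by
  intro e e' h
  obtain ⟨v⟩ := hT.connected.nonempty
  exact congrArg (fun α : plus T E 0 => α.1 ⟨fun _ => v, isCoherent_one hT _⟩) h

theorem exact_plusAug (hT : T.IsTree) : Function.Exact (plusAug T E) (plusDiff T E 0) := by
  intro α
  obtain ⟨v⟩ := hT.connected.nonempty
  constructor
  · intro h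
    have hd : cohDiff T E 0 α.1 = 0 := congrArg Subtype.val h
    refine ⟨α.1 ⟨fun _ => v, isCoherent_one hT _⟩, ?_⟩
    apply Subtype.ext
    ext x
    exact eq_of_cohDiff_eq_zero hT hd _ x
  · rintro ⟨e, rfl⟩
    apply Subtype.ext
    ext x
    refine (diff_apply (Coh.face 0) (plusAug T E e).1 x).trans ?_
    exact (congrFun (codiff_const e) x.1)

theorem exact_plusDiff (hT : T.IsTree) (q : ℕ) :
    Function.Exact (plusDiff T E q) (plusDiff T E (q + 1)) := by
  intro α
  obtain ⟨v⟩ := hT.connected.nonempty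
  constructor
  · intro h
    have hd : cohDiff T E (q + 1) α.1 = 0 := congrArg Subtype.val h
    obtain ⟨β, hβ, hαβ⟩ := exists_primitive hT v q α.2 hd
    exact ⟨⟨β, hβ⟩, Subtype.ext hαβ⟩
  · rintro ⟨β, rfl⟩
    exact Subtype.ext (cohDiff_cohDiff q β.1)

end Exactness

end AlignedCochains

end

theorem mainTheorem3 {V : Type*} (T : SimpleGraph V) (hT : T.IsTree)
    (hlf : ∀ v, (T.neighborSet v).Finite)
    {E : Type*} [NormedAddCommGroup E] [NormedSpace ℝ E] [CompleteSpace E]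
    (ρ : (T ≃g T) →* (E ≃ₗᵢ[ℝ] E)) :
    -- the complex `0 → E → ℓ^∞_+(coh^1, E) → ℓ^∞_+(coh^2, E) → ⋯` is exact
    (Function.Injective (AlignedCochains.plusAug T E) ∧
      Function.Exact (AlignedCochains.plusAug T E) (AlignedCochains.plusDiff T E 0) ∧
      ∀ q, Function.Exact (AlignedCochains.plusDiff T E q) (AlignedCochains.plusDiff T E (q + 1))) ∧
    -- `ℓ^∞(V^{q+1}, E)^{Aut(T)}` computes `H_cb` through orbit maps, and under this
    -- identification `A_q ∘ rest` is an isomorphism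
    ∀ q, ∃ Φ : AlignedCochains.Hcb ρ q ≃L[ℝ] AlignedCochains.HCoh ρ q,
      ∀ v : V, IsHomeomorph (AlignedCochains.orbitH ρ v q) ∧
        ∀ c, Φ (AlignedCochains.orbitH ρ v q c) = AlignedCochains.compH ρ q c := by
  exact ⟨⟨AlignedCochains.plusAug_injective hT, AlignedCochains.exact_plusAug hT,
    AlignedCochains.exact_plusDiff hT⟩, fun q =>
    AlignedCochains.exists_equiv_orbitH hT hlf ρ q⟩
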